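/- Conventions. All spaces are real. A quasi-Banach lattice is a vector lattice $E$ with a complete quasi-norm such that $|x|\le|y|$ implies $\|x\|\le\|y\|$. A compatible pair $(X_0,X_1)$ of quasi-Banach lattices consists of quasi-Banach lattices $X_0,X_1$ and injective, continuous, interval preserving lattice homomorphisms of $X_0$ and $X_1$ into a common Hausdorff locally solid topological vector lattice; $X_0,X_1$ are identified with their images, and $X_0+X_1$ has the quasi-norm $\|x\|=\inf\{\|x_0\|_{X_0}+\|x_1\|_{X_1}: x=x_0+x_1,\ x_i\in X_i\}$. $\mathcal P$ is the set of functions $\varphi:(0,\infty)^2\to[0,\infty)$ that are non-decreasing in each argument and satisfy $\varphi(\lambda s,\lambda t)=\lambda\varphi(s,t)$ for $\lambda>0$; such $\varphi$ is identified with its continuous extension to $[0,\infty)^2$. For $\varphi\in\mathcal P$, $$\varphi(X_0,X_1)=\{x\in X_0+X_1: |x|\le\varphi(x_0,x_1)\text{ for some }0\le x_0\in X_0,\ 0\le x_1\in X_1\},$$ where $\varphi(x_0,x_1)\in X_0+X_1$ is given by Krivine's functional calculus, with the quasi-norm $$\|x\|_{\varphi(X_0,X_1)}=\inf\{\lambda>0:|x|\le\lambda\varphi(x_0,x_1),\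 0\le x_i\in X_i,\ \|x_0\|_{X_0}\le1,\ \|x_1\|_{X_1}\le1\}.$$ The Gagliardo completion $\varphi^c(X_0,X_1)$ is the quasi-normed subspace of $X_0+X_1$ whose unit ball is the closure in $X_0+X_1$ of the unit ball of $\varphi(X_0,X_1)$. A linear operator $T:E\to F$ between quasi-normed lattices is $(\infty,1)$-regular if there is $K>0$ with $$\Big\|\bigvee_{i=1}^n|Tx_i|\Big\|_F\le K\Big\|\sum_{i=1}^n|x_i|\Big\|_E\qquad\text{for all } n\ge1,\ x_1,\dots,x_n\in E,$$ and $\rho_{\infty,1}(T)$ denotes the infimum of all such $K$. Theorem 3.1. Let $(X_0,X_1)$ and $(Y_0,Y_1)$ be compatible pairs of quasi-Banach lattices and let $\varphi\in\mathcal P$. There is a constant $C>0$, depending only on $X_0,X_1,Y_0,Y_1$ and $\varphi$, such that for every bounded linear operator $T:X_0+X_1\to Y_0+Y_1$ which maps $X_i$ into $Y_i$ with $T|_{X_i}:X_i\to Y_i$ $(\infty,1)$-regular for $i=0,1$, the operator $T$ maps $\varphi^c(X_0,X_1)$ into $\varphi^c(Y_0,Y_1)$, the restriction $T|_{\varphi^c(X_0,X_1)}:\varphi^c(X_0,X_1)\to\varphi^c(Y_0,Y_1)$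 is $(\infty,1)$-regular, and $$\rho_{\infty,1}\big(T|_{\varphi^c(X_0,X_1)}\big)\le C\max\{\rho_{\infty,1}(T|_{X_0}),\rho_{\infty,1}(T|_{X_1})\}.$$ -/

import Mathlib

namespace CalderonLozanovskii

universe u v w

/-- A (real) quasi-Banach lattice: a vector lattice with a complete quasi-norm which is monotone
with respect to the absolute value. -/
class QuasiBanachLattice (E : Type u) extends AddCommGroup E, Lattice E, Module ℝ E,
    IsOrderedAddMonoid E, IsOrderedModule ℝ E where
  /-- The quasi-norm. -/
  qnorm : E → ℝ
  qnorm_nonneg : ∀ x, 0 ≤ qnorm x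
  qnorm_eq_zero_iff : ∀ x, qnorm x = 0 ↔ x = 0
  qnorm_smul : ∀ (c : ℝ) (x : E), qnorm (c • x) = |c| * qnorm x
  exists_qnorm_add_le : ∃ C : ℝ, 1 ≤ C ∧ ∀ x y, qnorm (x + y) ≤ C * (qnorm x + qnorm y)
  qnorm_le_of_abs_le : ∀ x y : E, |x| ≤ |y| → qnorm x ≤ qnorm y
  /-- Every Cauchy sequence converges. -/
  complete : ∀ s : ℕ → E,
    (∀ ε : ℝ, 0 < ε → ∃ N, ∀ m n, N ≤ m → N ≤ n → qnorm (s m - s n) < ε) →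
    ∃ x, ∀ ε : ℝ, 0 < ε → ∃ N, ∀ n, N ≤ n → qnorm (s n - x) < ε


/-- A Hausdorff, locally solid topological vector lattice. -/
class LocallySolidVectorLattice (X : Type u) extends AddCommGroup X, Lattice X, Module ℝ X,
    IsOrderedAddMonoid X, IsOrderedModule ℝ X, TopologicalSpace X, IsTopologicalAddGroup X,
    ContinuousSMul ℝ X, T2Space X where
  exists_solid_nhds : ∀ U ∈ nhds (0 : X), ∃ V ∈ nhds (0 : X), V ⊆ U ∧
    LatticeOrderedAddCommGroup.IsSolid V

/-- `j` is an injective, continuous (for the quasi-norm topology), interval preserving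
lattice homomorphism. -/
structure IsLatticeInclusion {E : Type u} {X : Type v} [QuasiBanachLattice E]
    [LocallySolidVectorLattice X] (j : E →ₗ[ℝ] X) : Prop where
  injective : Function.Injective j
  continuous : ∀ U ∈ nhds (0 : X), ∃ δ : ℝ, 0 < δ ∧
    ∀ x, QuasiBanachLattice.qnorm x < δ → j x ∈ U
  map_sup : ∀ x y, j (x ⊔ y) = j x ⊔ j y
  map_inf : ∀ x y, j (x ⊓ y) = j x ⊓ j y
  image_Icc : ∀ x, 0 ≤ x → j '' Set.Icc 0 x = Set.Icc 0 (j x)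

/-- A compatible pair structure on the quasi-Banach lattices `X₀`, `X₁`: inclusions of both of them
into a common Hausdorff locally solid topological vector lattice. -/
structure CompatiblePair (X₀ X₁ : Type*) [QuasiBanachLattice X₀] [QuasiBanachLattice X₁] where
  Ambient : Type w
  [inst : LocallySolidVectorLattice Ambient]
  j₀ : X₀ →ₗ[ℝ] Ambient
  j₁ : X₁ →ₗ[ℝ] Ambient
  isLatticeInclusion₀ : IsLatticeInclusion j₀
  isLatticeInclusion₁ : IsLatticeInclusion j₁

attribute [instance] CompatiblePair.inst

namespace CompatiblePair

variable {X₀ : Type u} {X₁ : Type v} [QuasiBanachLattice X₀] [QuasiBanachLattice X₁]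
  (P : CompatiblePair.{w} X₀ X₁)

/-- The linear subspace `X₀ + X₁` of the ambient space. -/
def sumSubmodule : Submodule ℝ P.Ambient := LinearMap.range P.j₀ ⊔ LinearMap.range P.j₁

theorem posPart_mem {x : P.Ambient} (hx : x ∈ P.sumSubmodule) : x ⊔ 0 ∈ P.sumSubmodule := by
  obtain ⟨_, ⟨a, rfl⟩, _, ⟨b, rfl⟩, rfl⟩ := Submodule.mem_sup.1 hx
  have h0 : ∀ a, P.j₀ (a ⊔ 0) = P.j₀ a ⊔ 0 := fun a => by
    rw [P.isLatticeInclusion₀.map_sup, map_zero]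
  have h1 : ∀ a, P.j₁ (a ⊔ 0) = P.j₁ a ⊔ 0 := fun a => by
    rw [P.isLatticeInclusion₁.map_sup, map_zero]
  set z := (P.j₀ a + P.j₁ b) ⊔ 0 with hz
  set p := P.j₀ a ⊔ 0 with hp
  set q := P.j₁ b ⊔ 0 with hq
  have hz0 : 0 ≤ z := le_sup_right
  have hp0 : 0 ≤ p := le_sup_right
  have hq0 : 0 ≤ q := le_sup_right
  have hzpq : z ≤ p + q := sup_le (add_le_add le_sup_left le_sup_left) (add_nonneg hp0 hq0)
  have m0 : z ⊓ p ∈ LinearMap.range P.j₀ := by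
    have : z ⊓ p ∈ P.j₀ '' Set.Icc 0 (a ⊔ 0) := by
      rw [P.isLatticeInclusion₀.image_Icc _ le_sup_right, h0]
      exact ⟨le_inf hz0 hp0, inf_le_right⟩
    obtain ⟨c, -, hc⟩ := this
    exact ⟨c, hc⟩
  have m1 : z - z ⊓ p ∈ LinearMap.range P.j₁ := by
    have : z - z ⊓ p ∈ P.j₁ '' Set.Icc 0 (b ⊔ 0) := by
      rw [P.isLatticeInclusion₁.image_Icc _ le_sup_right, h1]
      refine ⟨sub_nonneg.2 inf_le_left, ?_⟩
      rw [sub_le_comm]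
      exact le_inf (sub_le_self _ hq0) (sub_le_iff_le_add.2 hzpq)
    obtain ⟨c, -, hc⟩ := this
    exact ⟨c, hc⟩
  have : z = z ⊓ p + (z - z ⊓ p) := by abel
  rw [this]
  exact Submodule.add_mem_sup m0 m1

theorem sup_mem {x y : P.Ambient} (hx : x ∈ P.sumSubmodule) (hy : y ∈ P.sumSubmodule) :
    x ⊔ y ∈ P.sumSubmodule := by
  have h : x ⊔ y = (x - y) ⊔ 0 + y := by rw [sup_add]; simp
  rw [h]
  exact add_mem (P.posPart_mem (sub_mem hx hy)) hy

theorem inf_mem {x y : P.Ambient} (hx : x ∈ P.sumSubmodule) (hy : y ∈ P.sumSubmodule) :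
    x ⊓ y ∈ P.sumSubmodule := by
  have h : x ⊓ y = x + y - x ⊔ y := by rw [← inf_add_sup x y]; abel
  rw [h]
  exact sub_mem (add_mem hx hy) (P.sup_mem hx hy)

/-- The space `X₀ + X₁`, with the order and the linear structure of the ambient space. -/
abbrev Sum : Type w := ↥P.sumSubmodule

/-- `X₀ + X₁` is a sublattice of the ambient space. -/
instance : Lattice P.Sum :=
  Subtype.lattice (P := fun x => x ∈ P.sumSubmodule)
    (fun _ _ hx hy => P.sup_mem hx hy) (fun _ _ hx hy => P.inf_mem hx hy)

/-- The inclusion of `X₀` into `X₀ + X₁`. -/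
def ι₀ : X₀ →ₗ[ℝ] P.Sum :=
  P.j₀.codRestrict P.sumSubmodule fun x => Submodule.mem_sup_left ⟨x, rfl⟩

/-- The inclusion of `X₁` into `X₀ + X₁`. -/
def ι₁ : X₁ →ₗ[ℝ] P.Sum :=
  P.j₁.codRestrict P.sumSubmodule fun x => Submodule.mem_sup_right ⟨x, rfl⟩

/-- The quasi-norm of `X₀ + X₁`. -/
noncomputable def sumNorm (x : P.Sum) : ℝ :=
  sInf {r : ℝ | ∃ (x₀ : X₀) (x₁ : X₁), x = P.ι₀ x₀ + P.ι₁ x₁ ∧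
    r = QuasiBanachLattice.qnorm x₀ + QuasiBanachLattice.qnorm x₁}

end CompatiblePair

/-- The class `𝒫` of functions on `(0, ∞) × (0, ∞)` with values in `[0, ∞)` that are homogeneous and
non-decreasing in each argument. Only the values at pairs of positive numbers matter. -/
structure ClassP (φ : ℝ → ℝ → ℝ) : Prop where
  nonneg : ∀ s t, 0 < s → 0 < t → 0 ≤ φ s t
  homogeneous : ∀ c s t, 0 < c → 0 < s → 0 < t → φ (c * s) (c * t) = c * φ s t
  mono_left : ∀ s s' t, 0 < s → s ≤ s' → 0 < t → φ s t ≤ φ s' t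
  mono_right : ∀ s t t', 0 < s → 0 < t → t ≤ t' → φ s t ≤ φ s t'

/-- The space of continuous positively `1`-homogeneous functions on `ℝ²`. -/
def homogSubmodule : Submodule ℝ C(ℝ × ℝ, ℝ) where
  carrier := {f | ∀ (c : ℝ) (p : ℝ × ℝ), 0 ≤ c → f (c • p) = c * f p}
  add_mem' := fun {f g} hf hg c p hc => by
    rw [ContinuousMap.add_apply, ContinuousMap.add_apply, hf c p hc, hg c p hc, mul_add]
  zero_mem' := fun c p _ => by simp
  smul_mem' := fun a f hf c p hc => by
    rw [ContinuousMap.smul_apply, ContinuousMap.smul_apply, hf c p hc, smul_eq_mul, smul_eq_mul]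
    ring

abbrev Homog : Type := ↥homogSubmodule

/-- The pointwise lattice operations on the continuous positively homogeneous functions. -/
noncomputable instance : Lattice Homog :=
  Subtype.lattice (P := fun f => f ∈ homogSubmodule)
    (fun f g hf hg c p hc => by
      rw [ContinuousMap.sup_apply, ContinuousMap.sup_apply, hf c p hc, hg c p hc]
      exact (mul_max_of_nonneg _ _ hc).symm)
    (fun f g hf hg c p hc => by
      rw [ContinuousMap.inf_apply, ContinuousMap.inf_apply, hf c p hc, hg c p hc]
      exact (mul_min_of_nonneg _ _ hc).symm)

/-- The first coordinate function. -/
def Homog.fst : Homog := ⟨⟨Prod.fst, continuous_fst⟩, fun _ _ _ => rfl⟩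

/-- The second coordinate function. -/
def Homog.snd : Homog := ⟨⟨Prod.snd, continuous_snd⟩, fun _ _ _ => rfl⟩

/-- `τ` is Krivine's functional calculus at `(x₀, x₁)`: the (unique) linear lattice homomorphism
from the continuous positively homogeneous functions on `ℝ²` which takes the coordinate functions
to `x₀` and `x₁`. -/
structure IsKrivineCalculus {L : Type*} [AddCommGroup L] [Lattice L] [Module ℝ L] (x₀ x₁ : L)
    (τ : Homog →ₗ[ℝ] L) : Prop where
  map_sup : ∀ f g, τ (f ⊔ g) = τ f ⊔ τ g
  map_inf : ∀ f g, τ (f ⊓ g) = τ f ⊓ τ g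
  map_fst : τ Homog.fst = x₀
  map_snd : τ Homog.snd = x₁

/-- `f` is the function `φ̂(s, t) = φ(s ∨ 0, t ∨ 0)` on `ℝ²`, where `φ` also denotes the continuous
extension of `φ` to the closed quadrant. -/
def IsExtension (φ : ℝ → ℝ → ℝ) (f : Homog) : Prop :=
  (∀ s t, 0 < s → 0 < t → f.1 (s, t) = φ s t) ∧ ∀ s t, f.1 (s, t) = f.1 (max s 0, max t 0)

/-- `y = φ(x₀, x₁)` in the sense of Krivine's functional calculus, for `x₀, x₁ ≥ 0`. -/
def IsValue {L : Type*} [AddCommGroup L] [Lattice L] [Module ℝ L] (φ : ℝ → ℝ → ℝ)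
    (x₀ x₁ y : L) : Prop :=
  ∃ (τ : Homog →ₗ[ℝ] L) (f : Homog), IsKrivineCalculus x₀ x₁ τ ∧ IsExtension φ f ∧ y = τ f

/-- The unit ball of the Gagliardo completion in `E`, whose topology is given by the quasi-norm `M`,
of the subspace `A` with quasi-norm `N`: the closure of `{x ∈ A | N x ≤ 1}` in `E`. -/
def gagliardoBall {E : Type*} [AddCommGroup E] (M : E → ℝ) (A : Set E) (N : E → ℝ) : Set E :=
  {x | ∀ ε : ℝ, 0 < ε → ∃ a ∈ A, N a ≤ 1 ∧ M (x - a) < ε}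

/-- The space with unit ball `B`. -/
def spaceOfBall {E : Type*} [AddCommGroup E] [Module ℝ E] (B : Set E) : Set E :=
  {x | ∃ r : ℝ, 0 < r ∧ ∃ b ∈ B, x = r • b}

/-- The quasi-norm with unit ball `B`. -/
noncomputable def normOfBall {E : Type*} [AddCommGroup E] [Module ℝ E] (B : Set E) (x : E) : ℝ :=
  sInf {r : ℝ | 0 < r ∧ ∃ b ∈ B, x = r • b}

namespace CompatiblePair

variable {X₀ : Type u} {X₁ : Type v} [QuasiBanachLattice X₀] [QuasiBanachLattice X₁]
  (P : CompatiblePair.{w} X₀ X₁) (φ : ℝ → ℝ → ℝ)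

/-- The Calderón–Lozanovskii space `φ(X₀, X₁)`. -/
def clSpace : Set P.Sum :=
  {x | ∃ (x₀ : X₀) (x₁ : X₁) (y : P.Sum), 0 ≤ x₀ ∧ 0 ≤ x₁ ∧
    IsValue φ (P.ι₀ x₀) (P.ι₁ x₁) y ∧ |x| ≤ y}

/-- The quasi-norm of `φ(X₀, X₁)`. -/
noncomputable def clNorm (x : P.Sum) : ℝ :=
  sInf {r : ℝ | 0 < r ∧ ∃ (x₀ : X₀) (x₁ : X₁) (y : P.Sum), 0 ≤ x₀ ∧ 0 ≤ x₁ ∧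
    QuasiBanachLattice.qnorm x₀ ≤ 1 ∧ QuasiBanachLattice.qnorm x₁ ≤ 1 ∧
    IsValue φ (P.ι₀ x₀) (P.ι₁ x₁) y ∧ |x| ≤ r • y}

/-- The unit ball of `φᶜ(X₀, X₁)`, the Gagliardo completion of `φ(X₀, X₁)` in `X₀ + X₁`. -/
def phiCBall : Set P.Sum := gagliardoBall P.sumNorm (P.clSpace φ) (P.clNorm φ)

/-- The space `φᶜ(X₀, X₁)`. -/
def phiC : Set P.Sum := spaceOfBall (P.phiCBall φ)

/-- The quasi-norm of `φᶜ(X₀, X₁)`. -/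
noncomputable def phiCNorm (x : P.Sum) : ℝ := normOfBall (P.phiCBall φ) x

end CompatiblePair

section Regular

variable {E F : Type*} [AddCommGroup E] [Lattice E] [Module ℝ E] [AddCommGroup F] [Lattice F]
  [Module ℝ F]

/-- `T` maps the space `D` with quasi-norm `N` into the space `D'` with quasi-norm `N'`, and
`‖⋁ |T xᵢ|‖ ≤ K ‖∑ |xᵢ|‖` for all finite families in `D` (the element on the left being in `D'`). -/
def RegularBound (T : E →ₗ[ℝ] F) (D : Set E) (N : E → ℝ) (D' : Set F) (N' : F → ℝ) (K : ℝ) :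
    Prop :=
  Set.MapsTo T D D' ∧ ∀ (n : ℕ) (x : Fin (n + 1) → E), (∀ i, x i ∈ D) →
    Finset.univ.sup' Finset.univ_nonempty (fun i => |T (x i)|) ∈ D' ∧
    N' (Finset.univ.sup' Finset.univ_nonempty fun i => |T (x i)|) ≤ K * N (∑ i, |x i|)

/-- `T` is `(∞, 1)`-regular from `D` (with quasi-norm `N`) to `D'` (with quasi-norm `N'`). -/
def IsInftyOneRegular (T : E →ₗ[ℝ] F) (D : Set E) (N : E → ℝ) (D' : Set F) (N' : F → ℝ) : Prop :=
  ∃ K : ℝ, 0 < K ∧ RegularBound T D N D' N' K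

/-- The constant `ρ_{∞,1}(T)`. -/
noncomputable def rhoInftyOne (T : E →ₗ[ℝ] F) (D : Set E) (N : E → ℝ) (D' : Set F) (N' : F → ℝ) :
    ℝ :=
  sInf {K : ℝ | 0 < K ∧ RegularBound T D N D' N' K}

end Regular

end CalderonLozanovskii

/-! The proof discretizes φ along a sparse set of dyadic rays. Let f be the continuous extension of
φ, ρ_e = f(1, 2^e) and σ_e = 2^(-e) ρ_e. A greedy choice of exponents (`exists_separated`) gives
finite sets on which, apart from one extra index, ρ at least doubles and σ at least halves, while
every exponent in the window [-J, J] is represented up to a factor 4. Hence f(x₀, x₁) is dominated,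
up to δx₀ + δx₁, by ∑ ρ_e Z_e + f(1,0) x₀ + f(0,1) x₁ with ∑ Z_e ≤ 16 x₀ and ∑ 2^e Z_e ≤ 16 x₁
(`IsKrivineCalculus.exists_discretization`).

If ∑ |x_i| lies below such a discrete sum, Riesz decomposition gives x_i = ∑_e ρ_e z_{e,i} + f(1,0)
g_i + f(0,1) h_i. The family of all z_{e,i} and g_i is controlled in X₀, that of all 2^e z_{e,i} and
h_i in X₁. Regularity, applied once in each space to all e and i together, yields y₀, y₁ with |T
z_{e,i}| ≤ y₀ ∧ 2^(-e) y₁. Geometric growth and decay give ∑ ρ_e (y₀ ∧ 2^(-e) y₁) ≤ 5 f(y₀, y₁), and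
therefore |T x_i| ≤ 7 f(y₀, y₁) for every i (`IsDiscretized.exists_majorant`).

For the Gagliardo completion all of this holds up to errors small in X₀ + X₁. Since T is bounded
there, the closure absorbs them (`IsApproximable.smul_sup'_mem_phiCBall`). The resulting constant
448 = 7 · 2 · 32 is absolute.

The value f(y₀, y₁) has to exist in Y₀ + Y₁. Krivine's calculus is built from real lattice
characters of the order ideal of y₀ + y₁, which determine its order by the Archimedean property
(`le_of_forall_isCharacter`), from the lattice form of Stone–Weierstrass, and from relative uniform
completeness. -/

namespace CalderonLozanovskii

set_option linter.unusedSectionVars false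

universe u v w u' v' w'

/-! ### Riesz decomposition of finite families in vector lattices. -/

section VectorLattice

variable {L : Type*} [AddCommGroup L] [Lattice L] [IsOrderedAddMonoid L]

theorem abs_sum_le_sum_abs_of_lattice {ι : Type*} (s : Finset ι) (x : ι → L) :
    |∑ i ∈ s, x i| ≤ ∑ i ∈ s, |x i| := by
  classical
  induction s using Finset.induction_on with
  | empty => simp
  | insert i s hi ih =>
    rw [Finset.sum_insert hi, Finset.sum_insert hi]
    exact (abs_add_le _ _).trans (add_le_add le_rfl ih)

/-- Take x⁺ ⊓ c from the positive part and the missing c - x⁺ ⊓ c from the negative part, which is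
large enough because c ≤ x⁺ + x⁻. Both the piece removed and the rest are differences of positive
elements, whose absolute values are at most the sums. -/
theorem exists_clip_of_le_abs (x c : L) (hc : 0 ≤ c) (hcx : c ≤ |x|) :
    ∃ p : L, |p| ≤ c ∧ |x - p| ≤ |x| - c := by
  have hx : x⁺ - x⁻ = x := posPart_sub_negPart x
  have hax : x⁺ + x⁻ = |x| := posPart_add_negPart x
  have h1 : 0 ≤ x⁺ := posPart_nonneg x
  have h2 : 0 ≤ x⁻ := negPart_nonneg x
  generalize hP : x⁺ = p at *
  generalize hN : x⁻ = m at *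
  have hu : 0 ≤ p ⊓ c := le_inf h1 hc
  have hw : 0 ≤ c - p ⊓ c := sub_nonneg.2 inf_le_right
  have hwm : c - p ⊓ c ≤ m := by
    rw [sub_inf]
    refine sup_le ?_ (by simpa using h2)
    rw [sub_le_iff_le_add, add_comm, hax]
    exact hcx
  have key : ∀ a b : L, 0 ≤ a → 0 ≤ b → |a - b| ≤ a + b := fun a b ha hb =>
    abs_le'.2 ⟨by rw [sub_eq_add_neg]; exact add_le_add le_rfl ((neg_nonpos.2 hb).trans hb),
      by rw [neg_sub, sub_eq_add_neg, add_comm]; exact add_le_add ((neg_nonpos.2 ha).trans ha) le_rfl⟩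
  refine ⟨p ⊓ c - (c - p ⊓ c), (key _ _ hu hw).trans_eq (by abel), ?_⟩
  have e : x - (p ⊓ c - (c - p ⊓ c)) = (p - p ⊓ c) - (m - (c - p ⊓ c)) := by rw [← hx]; abel
  rw [e]
  refine (key _ _ (sub_nonneg.2 inf_le_left) (sub_nonneg.2 hwm)).trans_eq ?_
  rw [← hax]; abel

/-- A finite family can be cut down so that the sum of the absolute values is at most `a`. -/
theorem exists_clip {ι : Type*} (s : Finset ι) (x : ι → L) (a : L) (ha : 0 ≤ a) :
    ∃ p : ι → L, ∑ i ∈ s, |p i| ≤ a ∧ ∑ i ∈ s, |x i - p i| ≤ (∑ i ∈ s, |x i| - a) ⊔ 0 := by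
  classical
  suffices h : ∃ p : ι → L, ∑ i ∈ s, |p i| ≤ (∑ i ∈ s, |x i|) ⊓ a ∧
      ∑ i ∈ s, |x i - p i| ≤ ∑ i ∈ s, |x i| - (∑ i ∈ s, |x i|) ⊓ a by
    obtain ⟨p, h1, h2⟩ := h
    refine ⟨p, h1.trans inf_le_right, h2.trans_eq ?_⟩
    rw [sub_inf, sub_self, sup_comm]
  induction s using Finset.induction_on with
  | empty => exact ⟨x, by simpa using ha, by simp [inf_eq_left.2 ha]⟩
  | insert i s hi ih =>
    obtain ⟨p, h1, h2⟩ := ih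
    set S := ∑ i ∈ s, |x i| with hS
    have hS' : ∑ j ∈ insert i s, |x j| = |x i| + S := Finset.sum_insert hi
    -- The share given to the new member is the increment of the partial sums truncated at a; these
    -- increments telescope to (∑ |x j|) ⊓ a.
    have hc0 : 0 ≤ (|x i| + S) ⊓ a - S ⊓ a :=
      sub_nonneg.2 (inf_le_inf (le_add_of_nonneg_left (abs_nonneg _)) le_rfl)
    have hc1 : (|x i| + S) ⊓ a - S ⊓ a ≤ |x i| := by
      rw [sub_le_iff_le_add, add_inf]
      exact inf_le_inf le_rfl (le_add_of_nonneg_left (abs_nonneg _))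
    obtain ⟨q, hq1, hq2⟩ := exists_clip_of_le_abs (x i) _ hc0 hc1
    have hne : ∀ j ∈ s, j ≠ i := fun j hj h => hi (h ▸ hj)
    have e1 : ∑ j ∈ s, |Function.update p i q j| = ∑ j ∈ s, |p j| :=
      Finset.sum_congr rfl fun j hj => by rw [Function.update_of_ne (hne j hj)]
    have e2 : ∑ j ∈ s, |x j - Function.update p i q j| = ∑ j ∈ s, |x j - p j| :=
      Finset.sum_congr rfl fun j hj => by rw [Function.update_of_ne (hne j hj)]
    refine ⟨Function.update p i q, ?_, ?_⟩
    · rw [Finset.sum_insert hi, e1, hS', Function.update_self]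
      exact (add_le_add hq1 h1).trans_eq (by abel)
    · rw [Finset.sum_insert hi, e2, hS', Function.update_self]
      exact (add_le_add hq2 h2).trans_eq (by abel)

theorem exists_riesz_two {ι : Type*} (s : Finset ι) (x : ι → L) (a b : L)
    (ha : 0 ≤ a) (hb : 0 ≤ b) (h : ∑ i ∈ s, |x i| ≤ a + b) :
    ∃ p q : ι → L, (∀ i, x i = p i + q i) ∧ ∑ i ∈ s, |p i| ≤ a ∧ ∑ i ∈ s, |q i| ≤ b := by
  obtain ⟨p, h1, h2⟩ := exists_clip s x a ha
  refine ⟨p, fun i => x i - p i, fun i => (add_sub_cancel _ _).symm, h1, h2.trans (sup_le ?_ hb)⟩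
  rw [sub_le_iff_le_add, add_comm]
  exact h

/-- The Riesz decomposition property for finite families. -/
theorem exists_riesz {ι κ : Type*} (s : Finset ι) (E : Finset κ) (x : ι → L) (W : κ → L)
    (hW : ∀ e, 0 ≤ W e) (h : ∑ i ∈ s, |x i| ≤ ∑ e ∈ E, W e) :
    ∃ X : κ → ι → L, (∀ i ∈ s, x i = ∑ e ∈ E, X e i) ∧ ∀ e ∈ E, ∑ i ∈ s, |X e i| ≤ W e := by
  classical
  induction E using Finset.induction_on generalizing x with
  | empty =>
    refine ⟨fun _ _ => 0, fun i hi => ?_, by simp⟩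
    rw [Finset.sum_empty] at h ⊢
    have h0 : |x i| ≤ 0 := (Finset.single_le_sum (fun j _ => abs_nonneg (x j)) hi).trans h
    exact le_antisymm ((le_abs_self _).trans h0) (neg_nonpos.1 ((neg_le_abs _).trans h0))
  | insert e E he ih =>
    rw [Finset.sum_insert he] at h
    obtain ⟨p, q, hpq, hp, hq⟩ := exists_riesz_two s x _ _ (hW e)
      (Finset.sum_nonneg fun e _ => hW e) h
    obtain ⟨X, hX, hXW⟩ := ih q hq
    have hne : ∀ j ∈ E, j ≠ e := fun j hj h => he (h ▸ hj)
    refine ⟨Function.update X e p, fun i hi => ?_, fun e' he' => ?_⟩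
    · rw [Finset.sum_insert he, Function.update_self, hpq i, hX i hi]
      congr 1
      exact Finset.sum_congr rfl fun j hj => by rw [Function.update_of_ne (hne j hj)]
    · rcases Finset.mem_insert.1 he' with rfl | h'
      · simpa using hp
      · rw [Function.update_of_ne (hne e' h')]
        exact hXW e' h'

theorem sup_zero_add_le (a b : L) : (a + b) ⊔ 0 ≤ a ⊔ 0 + b ⊔ 0 :=
  sup_le (add_le_add le_sup_left le_sup_left) (add_nonneg le_sup_right le_sup_right)

variable [Module ℝ L] [IsOrderedModule ℝ L]

theorem smul_sup_of_nonneg {c : ℝ} (hc : 0 ≤ c) (x y : L) : c • (x ⊔ y) = c • x ⊔ c • y := by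
  rcases hc.eq_or_lt with rfl | hc
  · simp
  · exact (OrderIso.smulRight hc).map_sup x y

theorem smul_inf_of_nonneg {c : ℝ} (hc : 0 ≤ c) (x y : L) : c • (x ⊓ y) = c • x ⊓ c • y := by
  rcases hc.eq_or_lt with rfl | hc
  · simp
  · exact (OrderIso.smulRight hc).map_inf x y

theorem abs_smul_of_lattice (c : ℝ) (x : L) : |c • x| = |c| • |x| := by
  have key : ∀ c : ℝ, 0 ≤ c → |c • x| = c • |x| := fun c hc => by
    rw [abs, abs, smul_sup_of_nonneg hc, smul_neg]
  rcases le_total 0 c with hc | hc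
  · rw [key c hc, abs_of_nonneg hc]
  · rw [← abs_neg, ← neg_smul, key (-c) (neg_nonneg.2 hc), abs_of_nonpos hc]

end VectorLattice

/-! ### Real characters of order ideals and their separation property. -/

section Character

variable {L : Type*} [AddCommGroup L] [Lattice L] [IsOrderedAddMonoid L] [Module ℝ L]
  [IsOrderedModule ℝ L]

/-- `x` belongs to the order ideal generated by `u`. -/
def OrderBounded (u x : L) : Prop := ∃ c : ℝ, |x| ≤ c • u

namespace OrderBounded

variable {u x y : L}

theorem add (hx : OrderBounded u x) (hy : OrderBounded u y) : OrderBounded u (x + y) := by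
  obtain ⟨a, ha⟩ := hx
  obtain ⟨b, hb⟩ := hy
  exact ⟨a + b, (abs_add_le _ _).trans (by rw [add_smul]; exact add_le_add ha hb)⟩

theorem smul (c : ℝ) (hx : OrderBounded u x) : OrderBounded u (c • x) := by
  obtain ⟨a, ha⟩ := hx
  refine ⟨|c| * a, ?_⟩
  rw [abs_smul_of_lattice, mul_smul]
  exact smul_le_smul_of_nonneg_left ha (abs_nonneg c)

theorem neg (hx : OrderBounded u x) : OrderBounded u (-x) := by
  simpa using hx.smul (-1)

theorem sub (hx : OrderBounded u x) (hy : OrderBounded u y) : OrderBounded u (x - y) := by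
  simpa [sub_eq_add_neg] using hx.add hy.neg

theorem of_abs_le (hx : OrderBounded u x) (h : |y| ≤ |x|) : OrderBounded u y := by
  obtain ⟨a, ha⟩ := hx
  exact ⟨a, h.trans ha⟩

theorem sup (hx : OrderBounded u x) (hy : OrderBounded u y) : OrderBounded u (x ⊔ y) := by
  obtain ⟨a, ha⟩ := hx
  obtain ⟨b, hb⟩ := hy
  have h1 := ha.trans' (abs_nonneg x)
  have h2 := hb.trans' (abs_nonneg y)
  refine ⟨a + b, abs_le'.2 ⟨sup_le ((le_abs_self _).trans ?_) ((le_abs_self _).trans ?_), ?_⟩⟩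
  · rw [add_smul]; exact ha.trans (le_add_of_nonneg_right h2)
  · rw [add_smul]; exact hb.trans (le_add_of_nonneg_left h1)
  · rw [neg_sup, add_smul]
    exact inf_le_left.trans ((neg_le_abs _).trans (ha.trans (le_add_of_nonneg_right h2)))

theorem inf (hx : OrderBounded u x) (hy : OrderBounded u y) : OrderBounded u (x ⊓ y) := by
  have := (hx.neg.sup hy.neg).neg
  rwa [neg_sup, neg_neg, neg_neg] at this

theorem self (hu : 0 ≤ u) : OrderBounded u u := ⟨1, by rw [one_smul, abs_of_nonneg hu]⟩

end OrderBounded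

/-- `h` restricts to a real-valued lattice homomorphism on the order ideal generated by `u`, with
`h u = 1`. -/
structure IsCharacter (u : L) (h : L → ℝ) : Prop where
  map_unit : h u = 1
  map_add : ∀ x y, OrderBounded u x → OrderBounded u y → h (x + y) = h x + h y
  map_smul : ∀ (c : ℝ) x, OrderBounded u x → h (c • x) = c * h x
  map_sup : ∀ x y, OrderBounded u x → OrderBounded u y → h (x ⊔ y) = max (h x) (h y)

namespace IsCharacter

variable {u : L} {h : L → ℝ} (hh : IsCharacter u h)
include hh

theorem map_neg {x : L} (hx : OrderBounded u x) : h (-x) = -h x := by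
  simpa using hh.map_smul (-1) x hx

theorem map_sub {x y : L} (hx : OrderBounded u x) (hy : OrderBounded u y) :
    h (x - y) = h x - h y := by
  rw [sub_eq_add_neg, hh.map_add _ _ hx hy.neg, hh.map_neg hy, sub_eq_add_neg]

theorem map_abs {x : L} (hx : OrderBounded u x) : h |x| = |h x| := by
  rw [abs, hh.map_sup _ _ hx hx.neg, hh.map_neg hx]
  rfl

theorem map_inf {x y : L} (hx : OrderBounded u x) (hy : OrderBounded u y) :
    h (x ⊓ y) = min (h x) (h y) := by
  have h1 := hh.map_sup _ _ hx.neg hy.neg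
  rw [← neg_inf, hh.map_neg (hx.inf hy), hh.map_neg hx, hh.map_neg hy, max_neg_neg] at h1
  exact neg_injective h1

theorem mono {x y : L} (hx : OrderBounded u x) (hy : OrderBounded u y) (hxy : x ≤ y) :
    h x ≤ h y := by
  have h1 := hh.map_sup _ _ hx hy
  rw [sup_eq_right.2 hxy] at h1
  exact h1 ▸ le_max_left _ _

theorem map_zero : h 0 = 0 := by
  simpa using hh.map_smul 0 (0 : L) ⟨0, by simp⟩

end IsCharacter

/-- A linear subspace which is solid. -/
def IsSolidSubmodule (J : Submodule ℝ L) : Prop := ∀ x ∈ J, ∀ y : L, |y| ≤ |x| → y ∈ J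

/-- The solid subspace generated by the solid subspace `J` and `a`, for `a ≥ 0`. -/
def solidAdjoin (J : Submodule ℝ L) (hJ : IsSolidSubmodule J) (a : L) : Submodule ℝ L where
  carrier := {y | ∃ j ∈ J, ∃ c : ℝ, 0 ≤ c ∧ |y| ≤ |j| + c • a}
  add_mem' := by
    rintro x y ⟨j, hj, c, hc, hx⟩ ⟨k, hk, d, hd, hy⟩
    refine ⟨|j| + |k|, J.add_mem (hJ j hj _ (by rw [abs_abs])) (hJ k hk _ (by rw [abs_abs])),
      c + d, add_nonneg hc hd, (abs_add_le _ _).trans ((add_le_add hx hy).trans_eq ?_)⟩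
    rw [abs_of_nonneg (add_nonneg (abs_nonneg j) (abs_nonneg k)), add_smul]
    abel
  zero_mem' := ⟨0, J.zero_mem, 0, le_rfl, by simp⟩
  smul_mem' := by
    rintro r x ⟨j, hj, c, hc, hx⟩
    refine ⟨r • j, J.smul_mem r hj, |r| * c, mul_nonneg (abs_nonneg r) hc, ?_⟩
    rw [abs_smul_of_lattice, abs_smul_of_lattice, mul_smul, ← smul_add]
    exact smul_le_smul_of_nonneg_left hx (abs_nonneg r)

theorem exists_maximal_solid (q : L) (hq : q ≠ 0) :
    ∃ J : Submodule ℝ L, IsSolidSubmodule J ∧ q ∉ J ∧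
      ∀ J' : Submodule ℝ L, IsSolidSubmodule J' → q ∉ J' → J ≤ J' → J' = J := by
  obtain ⟨J, -, hJ⟩ := zorn_le_nonempty₀ {J : Submodule ℝ L | IsSolidSubmodule J ∧ q ∉ J}
    (fun c hc hchain y hy => by
      have hdir : DirectedOn (· ≤ ·) c := hchain.directedOn
      refine ⟨sSup c, ⟨fun x hx z hz => ?_, fun hqc => ?_⟩, fun z hz => le_sSup hz⟩
      · obtain ⟨K, hK, hxK⟩ := (Submodule.mem_sSup_of_directed ⟨y, hy⟩ hdir).1 hx
        exact (Submodule.mem_sSup_of_directed ⟨y, hy⟩ hdir).2 ⟨K, hK, (hc hK).1 x hxK z hz⟩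
      · obtain ⟨K, hK, hxK⟩ := (Submodule.mem_sSup_of_directed ⟨y, hy⟩ hdir).1 hqc
        exact (hc hK).2 hxK) ⊥
    ⟨fun x hx z hz => by
      rw [Submodule.mem_bot] at hx ⊢
      rw [hx, abs_zero] at hz
      exact le_antisymm ((le_abs_self _).trans hz) (neg_nonpos.1 ((neg_le_abs _).trans hz)),
      by simpa using hq⟩
  exact ⟨J, hJ.prop.1, hJ.prop.2, fun J' h1 h2 h3 => le_antisymm (hJ.2 ⟨h1, h2⟩ h3) h3⟩

theorem IsSolidSubmodule.mem_of_le {J : Submodule ℝ L} (hJ : IsSolidSubmodule J) {x y : L}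
    (hx : x ∈ J) (hy : 0 ≤ y) (h : y ≤ x) : y ∈ J :=
  hJ x hx y (by rw [abs_of_nonneg hy, abs_of_nonneg (hy.trans h)]; exact h)

theorem IsSolidSubmodule.abs_mem {J : Submodule ℝ L} (hJ : IsSolidSubmodule J) {x : L}
    (hx : x ∈ J) : |x| ∈ J := hJ x hx _ (by rw [abs_abs])

/-- If neither a nor b is in J, maximality puts q into both enlarged solid subspaces: q ≤ |j| + c a
and q ≤ |k| + d b. Then q - |j| - |k| ≤ (c + d)(a ⊓ b) = 0, which forces q into J. -/
theorem IsSolidSubmodule.prime {J : Submodule ℝ L} {q : L} (hq : 0 ≤ q)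
    (hJ : IsSolidSubmodule J) (hqJ : q ∉ J)
    (hmax : ∀ J' : Submodule ℝ L, IsSolidSubmodule J' → q ∉ J' → J ≤ J' → J' = J)
    {a b : L} (hab : a ⊓ b = 0) : a ∈ J ∨ b ∈ J := by
  have ha : 0 ≤ a := hab ▸ inf_le_left
  have hb : 0 ≤ b := hab ▸ inf_le_right
  have key : ∀ a : L, 0 ≤ a → a ∉ J → ∃ j ∈ J, ∃ c : ℝ, 0 ≤ c ∧ q ≤ |j| + c • a := by
    intro a ha haJ
    by_contra hcon
    have h := hmax (solidAdjoin J hJ a) ?_ ?_ ?_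
    · exact haJ (h ▸ ⟨0, J.zero_mem, 1, zero_le_one, by simp [abs_of_nonneg ha]⟩)
    · rintro x ⟨j, hj, c, hc, hx⟩ y hy
      exact ⟨j, hj, c, hc, hy.trans hx⟩
    · rintro ⟨j, hj, c, hc, hx⟩
      exact hcon ⟨j, hj, c, hc, (le_abs_self q).trans hx⟩
    · intro x hx
      exact ⟨x, hx, 0, le_rfl, by simp⟩
  by_contra hcon
  rw [not_or] at hcon
  obtain ⟨j, hj, c, hc, h1⟩ := key a ha hcon.1
  obtain ⟨k, hk, d, hd, h2⟩ := key b hb hcon.2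
  have h3 : q ≤ |j| + |k| := by
    have h4 : q - (|j| + |k|) ≤ (c + d) • a := by
      rw [sub_le_iff_le_add, add_smul]
      calc q ≤ |j| + c • a := h1
        _ ≤ |j| + c • a + (d • a + |k|) :=
          le_add_of_nonneg_right (add_nonneg (smul_nonneg hd ha) (abs_nonneg _))
        _ = _ := by abel
    have h5 : q - (|j| + |k|) ≤ (c + d) • b := by
      rw [sub_le_iff_le_add, add_smul]
      calc q ≤ |k| + d • b := h2
        _ ≤ |k| + d • b + (c • b + |j|) :=
          le_add_of_nonneg_right (add_nonneg (smul_nonneg hc hb) (abs_nonneg _))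
        _ = _ := by abel
    have h6 := le_inf h4 h5
    rw [← smul_inf_of_nonneg (add_nonneg hc hd), hab, smul_zero] at h6
    exact sub_nonpos.1 h6
  exact hqJ (hJ.mem_of_le (J.add_mem (hJ.abs_mem hj) (hJ.abs_mem hk)) hq h3)

/-- The standard part, relative to `u`, of an element modulo `J`. -/
noncomputable def standardPart (J : Submodule ℝ L) (u y : L) : ℝ :=
  sSup {r : ℝ | (r • u - y) ⊔ 0 ∈ J}

section StandardPart

variable {J : Submodule ℝ L} {u : L} (hJ : IsSolidSubmodule J) (huJ : u ∉ J) (hu : 0 ≤ u)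
  (hprime : ∀ a b : L, a ⊓ b = 0 → a ∈ J ∨ b ∈ J)

theorem sup_zero_inf_sup_zero (a : L) : (a ⊔ 0) ⊓ (-a ⊔ 0) = 0 := posPart_inf_negPart_eq_zero a

include hJ huJ hu in
theorem nonpos_of_smul_sup_mem {r : ℝ} (h : (r • u) ⊔ 0 ∈ J) : r ≤ 0 := by
  by_contra hr
  rw [not_le] at hr
  rw [sup_eq_left.2 (smul_nonneg hr.le hu)] at h
  exact huJ (by simpa [smul_smul, inv_mul_cancel₀ hr.ne'] using J.smul_mem r⁻¹ h)

include hJ in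
theorem sup_mem_of_le_add {x y z : L} (h : x ≤ y + z) (hy : y ⊔ 0 ∈ J) (hz : z ⊔ 0 ∈ J) :
    x ⊔ 0 ∈ J :=
  hJ.mem_of_le (J.add_mem hy hz) le_sup_right
    ((sup_le_sup_right h 0).trans (sup_zero_add_le y z))

include hJ huJ hu in
theorem le_of_mem_mem {r s : ℝ} {y : L} (h1 : (r • u - y) ⊔ 0 ∈ J) (h2 : (y - s • u) ⊔ 0 ∈ J) :
    r ≤ s := by
  have := nonpos_of_smul_sup_mem (r := r - s) hJ huJ hu
    (sup_mem_of_le_add hJ (by rw [sub_smul]; exact (by abel : _ = _).le) h1 h2)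
  linarith

include hJ huJ hu in
theorem standardPart_set {y : L} (hy : OrderBounded u y) :
    {r : ℝ | (r • u - y) ⊔ 0 ∈ J}.Nonempty ∧ BddAbove {r : ℝ | (r • u - y) ⊔ 0 ∈ J} := by
  obtain ⟨c, hc⟩ := hy
  constructor
  · refine ⟨-c, ?_⟩
    have h1 : (-c) • u - y ≤ 0 := by
      rw [neg_smul]
      exact sub_nonpos.2 (neg_le.1 ((neg_le_abs y).trans hc))
    change ((-c) • u - y) ⊔ 0 ∈ J
    rw [sup_eq_right.2 h1]
    exact J.zero_mem
  · refine ⟨c, fun r hr => le_of_mem_mem hJ huJ hu hr ?_⟩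
    rw [sup_eq_right.2 (sub_nonpos.2 ((le_abs_self y).trans hc))]
    exact J.zero_mem

include hJ huJ hu in
theorem le_standardPart {r : ℝ} {y : L} (hy : OrderBounded u y) (h : (r • u - y) ⊔ 0 ∈ J) :
    r ≤ standardPart J u y :=
  le_csSup (standardPart_set hJ huJ hu hy).2 h

include hJ huJ hu in
theorem standardPart_le {r : ℝ} {y : L} (hy : OrderBounded u y) (h : (y - r • u) ⊔ 0 ∈ J) :
    standardPart J u y ≤ r :=
  csSup_le (standardPart_set hJ huJ hu hy).1 fun _ hs => le_of_mem_mem hJ huJ hu hs h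

include hJ huJ hu in
theorem mem_of_lt_standardPart {r : ℝ} {y : L} (hy : OrderBounded u y)
    (h : r < standardPart J u y) : (r • u - y) ⊔ 0 ∈ J := by
  obtain ⟨s, hs, hrs⟩ := exists_lt_of_lt_csSup (standardPart_set hJ huJ hu hy).1 h
  exact hJ.mem_of_le hs le_sup_right
    (sup_le_sup_right (sub_le_sub_right (smul_le_smul_of_nonneg_right hrs.le hu) _) _)

include hJ huJ hu hprime in
-- Primeness enters here: one of the positive parts of y - ru and ru - y lies in J, and the second
-- would make r a competitor in the supremum.
theorem mem_of_standardPart_lt {r : ℝ} {y : L} (hy : OrderBounded u y)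
    (h : standardPart J u y < r) : (y - r • u) ⊔ 0 ∈ J := by
  have h1 := sup_zero_inf_sup_zero (y - r • u)
  rw [neg_sub] at h1
  refine (hprime _ _ h1).resolve_right fun h2 => ?_
  exact absurd (le_standardPart hJ huJ hu hy h2) (not_le.2 h)

include hJ huJ hu hprime in
-- Membership of (x - y)⁺ in J is the order of the quotient by J, which primeness makes total. The
-- quotient may contain infinitesimals relative to u; the standard part discards them, so every
-- identity is checked up to ε.
theorem isCharacter_standardPart : IsCharacter u (standardPart J u) := by
  have hadd : ∀ x y, OrderBounded u x → OrderBounded u y →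
      standardPart J u (x + y) = standardPart J u x + standardPart J u y := by
    intro x y hx hy
    apply le_antisymm
    · refine le_of_forall_pos_le_add fun ε hε => ?_
      refine standardPart_le hJ huJ hu (hx.add hy) ?_
      refine sup_mem_of_le_add hJ (le_of_eq ?_)
        (mem_of_standardPart_lt hJ huJ hu hprime hx (lt_add_of_pos_right _ (half_pos hε)))
        (mem_of_standardPart_lt hJ huJ hu hprime hy (lt_add_of_pos_right _ (half_pos hε)))
      module
    · refine le_of_forall_pos_sub_le fun ε hε => ?_
      refine le_standardPart hJ huJ hu (hx.add hy) ?_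
      refine sup_mem_of_le_add hJ (le_of_eq ?_)
        (mem_of_lt_standardPart hJ huJ hu hx (sub_lt_self _ (half_pos hε)))
        (mem_of_lt_standardPart hJ huJ hu hy (sub_lt_self _ (half_pos hε)))
      module
  have hmono : ∀ x y, OrderBounded u x → OrderBounded u y → x ≤ y →
      standardPart J u x ≤ standardPart J u y := by
    intro x y hx hy hxy
    refine le_of_forall_pos_sub_le fun ε hε => ?_
    refine le_standardPart hJ huJ hu hy (hJ.mem_of_le
      (mem_of_lt_standardPart hJ huJ hu hx (sub_lt_self _ hε)) le_sup_right ?_)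
    exact sup_le_sup_right (sub_le_sub_left hxy _) _
  have hunit : standardPart J u u = 1 := by
    have hb := OrderBounded.self hu
    apply le_antisymm
    · refine standardPart_le hJ huJ hu hb ?_
      simp
    · refine le_standardPart hJ huJ hu hb ?_
      simp
  have h0 : standardPart J u 0 = 0 := by
    have hb : OrderBounded u (0 : L) := ⟨0, by simp⟩
    have := hadd 0 0 hb hb
    rw [add_zero] at this
    linarith
  have hpos : ∀ (c : ℝ) x, 0 < c → OrderBounded u x →
      c * standardPart J u x ≤ standardPart J u (c • x) := by
    intro c x hc hx
    refine le_of_forall_pos_sub_le fun ε hε => ?_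
    refine le_standardPart hJ huJ hu (hx.smul c) ?_
    have := J.smul_mem c (mem_of_lt_standardPart hJ huJ hu hx
      (sub_lt_self _ (div_pos hε hc)))
    rw [smul_sup_of_nonneg hc.le, smul_zero, smul_sub, smul_smul] at this
    convert this using 4
    field_simp
  have hpos' : ∀ (c : ℝ) x, 0 < c → OrderBounded u x →
      standardPart J u (c • x) = c * standardPart J u x := by
    intro c x hc hx
    refine le_antisymm ?_ (hpos c x hc hx)
    have := hpos c⁻¹ (c • x) (inv_pos.2 hc) (hx.smul c)
    rwa [smul_smul, inv_mul_cancel₀ hc.ne', one_smul, inv_mul_le_iff₀ hc] at this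
  refine ⟨hunit, hadd, fun c x hx => ?_, fun x y hx hy => le_antisymm ?_ ?_⟩
  · rcases lt_trichotomy c 0 with hc | rfl | hc
    · have h1 := hpos' (-c) x (neg_pos.2 hc) hx
      have h2 := hadd (c • x) ((-c) • x) (hx.smul c) (hx.smul (-c))
      rw [← add_smul, add_neg_cancel, zero_smul, h0] at h2
      linarith
    · simp [h0]
    · exact hpos' c x hc hx
  · refine le_of_forall_pos_le_add fun ε hε => ?_
    refine standardPart_le hJ huJ hu (hx.sup hy) ?_
    set r := max (standardPart J u x) (standardPart J u y) + ε with hr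
    have h1 : standardPart J u x < r := by
      rw [hr]; linarith [le_max_left (standardPart J u x) (standardPart J u y)]
    have h2 : standardPart J u y < r := by
      rw [hr]; linarith [le_max_right (standardPart J u x) (standardPart J u y)]
    have h3 := J.add_mem (mem_of_standardPart_lt hJ huJ hu hprime hx h1)
      (mem_of_standardPart_lt hJ huJ hu hprime hy h2)
    refine hJ.mem_of_le h3 le_sup_right ?_
    rw [sup_sub]
    refine sup_le (sup_le ?_ ?_) (add_nonneg le_sup_right le_sup_right)
    · exact le_sup_left.trans (le_add_of_nonneg_right le_sup_right)
    · exact le_sup_left.trans (le_add_of_nonneg_left le_sup_right)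
  · exact max_le (hmono _ _ hx (hx.sup hy) le_sup_left) (hmono _ _ hy (hx.sup hy) le_sup_right)

end StandardPart

/-- On an Archimedean vector lattice the characters of an order ideal with unit `u` determine the
order of the ideal. -/
theorem le_of_forall_isCharacter {u : L} (hu : 0 ≤ u)
    (harch : ∀ x : L, (∀ ε : ℝ, 0 < ε → x ≤ ε • u) → x ≤ 0) {x y : L}
    (hx : OrderBounded u x) (hy : OrderBounded u y)
    (h : ∀ χ : L → ℝ, IsCharacter u χ → χ x ≤ χ y) : x ≤ y := by
  suffices hs : ∀ x : L, OrderBounded u x → (∀ χ : L → ℝ, IsCharacter u χ → χ x ≤ 0) → x ≤ 0 by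
    refine sub_nonpos.1 (hs (x - y) (hx.sub hy) fun χ hχ => ?_)
    have h1 := hχ.map_add (x - y) y (hx.sub hy) hy
    rw [sub_add_cancel] at h1
    linarith [h χ hχ]
  clear h hx hy x y
  intro x hx h
  refine harch x fun ε hε => ?_
  by_contra hcon
  have hq0 : (x - ε • u) ⊔ 0 ≠ 0 := fun h0 => hcon (sub_nonpos.1 (sup_eq_right.1 h0))
  obtain ⟨J, hJ, hqJ, hmax⟩ := exists_maximal_solid _ hq0
  have hq : 0 ≤ (x - ε • u) ⊔ 0 := le_sup_right
  have huJ : u ∉ J := fun huJ => by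
    obtain ⟨c, hc⟩ := hx
    refine hqJ (hJ.mem_of_le (J.smul_mem c huJ) hq (sup_le ?_ ((abs_nonneg x).trans hc)))
    exact (sub_le_self _ (smul_nonneg hε.le hu)).trans ((le_abs_self x).trans hc)
  have hprime : ∀ a b : L, a ⊓ b = 0 → a ∈ J ∨ b ∈ J := fun a b hab =>
    hJ.prime hq hqJ hmax hab
  have h1 := h _ (isCharacter_standardPart hJ huJ hu hprime)
  have h2 := sup_zero_inf_sup_zero (x - ε • u)
  rw [neg_sub] at h2
  -- J misses (x - εu)⁺, so by primeness it contains (εu - x)⁺; the character is then at least ε at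
  -- x, against the hypothesis.
  have h3 := le_standardPart hJ huJ hu hx ((hprime _ _ h2).resolve_left hqJ)
  linarith

end Character

/-! ### Construction of Krivine's functional calculus. -/

section Krivine

variable {L : Type*} [AddCommGroup L] [Lattice L] [IsOrderedAddMonoid L] [Module ℝ L]
  [IsOrderedModule ℝ L]

/-- The continuous functions `g` on `[0, 1]` for which `g (x₁)` makes sense, relative to the unit
`u`. -/
def calculusSet (u x₁ : L) : Set C(unitInterval, ℝ) :=
  {g | ∃ e, OrderBounded u e ∧
    ∀ χ : L → ℝ, IsCharacter u χ → χ e = g (Set.projIcc 0 1 zero_le_one (χ x₁))}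

variable {u x₁ : L} (hu : 0 ≤ u)
  (harch : ∀ x : L, (∀ ε : ℝ, 0 < ε → x ≤ ε • u) → x ≤ 0)

include hu harch in
-- Characters turn uniform distance of functions into order bounds by multiples of u. Elements
-- realizing a rapidly converging sequence of functions thus form a relatively uniformly Cauchy
-- sequence, whose limit realizes the limit function.
theorem isClosed_calculusSet
    (hcomp : ∀ s : ℕ → L, (∀ n, |s (n + 1) - s n| ≤ ((1 / 2 : ℝ) ^ n) • u) →
      ∃ x, ∀ n, |x - s n| ≤ (2 * (1 / 2 : ℝ) ^ n) • u) :
    IsClosed (calculusSet u x₁) := by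
  refine isClosed_of_closure_subset fun g hg => ?_
  have hpow : ∀ n : ℕ, 0 < (1 / 2 : ℝ) ^ n := fun n => by positivity
  have hex : ∀ n : ℕ, ∃ g' ∈ calculusSet u x₁, dist g g' < (1 / 2 : ℝ) ^ n / 2 := fun n =>
    Metric.mem_closure_iff.1 hg _ (half_pos (hpow n))
  choose G hG hGd using hex
  choose e heb he using hG
  have hub := OrderBounded.self hu
  have hdist : ∀ n χ, IsCharacter u χ →
      |χ (e n) - g (Set.projIcc 0 1 zero_le_one (χ x₁))| ≤ (1 / 2 : ℝ) ^ n / 2 := by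
    intro n χ hχ
    rw [he n χ hχ, abs_sub_comm]
    exact (ContinuousMap.dist_apply_le_dist _).trans (hGd n).le
  obtain ⟨x, hx⟩ := hcomp e fun n => by
    have hb := (heb (n + 1)).sub (heb n)
    refine le_of_forall_isCharacter hu harch (hb.of_abs_le (by rw [abs_abs])) (hub.smul _) ?_
    intro χ hχ
    rw [hχ.map_abs hb, hχ.map_sub (heb _) (heb _), hχ.map_smul _ _ hub, hχ.map_unit, mul_one]
    have h1 := abs_le.1 (hdist n χ hχ)
    have h2 := abs_le.1 (hdist (n + 1) χ hχ)
    have h3 : (1 / 2 : ℝ) ^ (n + 1) = (1 / 2 : ℝ) ^ n / 2 := by rw [pow_succ]; ring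
    rw [h3] at h2
    have := hpow n
    exact abs_le.2 ⟨by linarith, by linarith⟩
  have hxb : OrderBounded u x := by
    have h1 : OrderBounded u (x - e 0) := ⟨_, hx 0⟩
    simpa using h1.add (heb 0)
  refine ⟨x, hxb, fun χ hχ => ?_⟩
  refine eq_of_forall_dist_le fun ε hε => ?_
  rw [Real.dist_eq]
  obtain ⟨n, hn⟩ := exists_pow_lt_of_lt_one (show 0 < ε / 3 by positivity)
    (show (1 / 2 : ℝ) < 1 by norm_num)
  have hb := hxb.sub (heb n)
  have h1 := hχ.mono (hb.of_abs_le (by rw [abs_abs])) (hub.smul _) (hx n)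
  rw [hχ.map_abs hb, hχ.map_sub hxb (heb n), hχ.map_smul _ _ hub, hχ.map_unit, mul_one] at h1
  have h1 := abs_le.1 h1
  have h2 := abs_le.1 (hdist n χ hχ)
  have := hpow n
  exact abs_le.2 ⟨by linarith, by linarith⟩

/-- Lattice form of Stone–Weierstrass: the set is closed under both lattice operations and contains
the affine functions a + bt, realized by a u + b x₁, which interpolate arbitrary values at two
points. -/
theorem calculusSet_eq_univ (hu : 0 ≤ u) (h1 : 0 ≤ x₁) (h2 : x₁ ≤ u)
    (hclosed : IsClosed (calculusSet u x₁)) : calculusSet u x₁ = Set.univ := by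
  have hub := OrderBounded.self hu
  have hxb : OrderBounded u x₁ := ⟨1, by rw [one_smul, abs_of_nonneg h1]; exact h2⟩
  have haff : ∀ a b : ℝ, (⟨fun t => a + b * t, by fun_prop⟩ : C(unitInterval, ℝ)) ∈
      calculusSet u x₁ := by
    refine fun a b => ⟨a • u + b • x₁, (hub.smul a).add (hxb.smul b), fun χ hχ => ?_⟩
    have h0 : χ x₁ ∈ Set.Icc (0 : ℝ) 1 := by
      constructor
      · rw [← hχ.map_zero]
        exact hχ.mono ⟨0, by simp⟩ hxb h1
      · rw [← hχ.map_unit]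
        exact hχ.mono hxb hub h2
    rw [hχ.map_add _ _ (hub.smul a) (hxb.smul b), hχ.map_smul _ _ hub, hχ.map_smul _ _ hxb,
      hχ.map_unit, mul_one, Set.projIcc_of_mem _ h0]
    rfl
  rw [← hclosed.closure_eq]
  refine ContinuousMap.sublattice_closure_eq_top _ ⟨_, haff 0 0⟩ ?_ ?_ ?_
  · rintro f ⟨a, ha, hfa⟩ g ⟨b, hb, hgb⟩
    refine ⟨a ⊓ b, ha.inf hb, fun χ hχ => ?_⟩
    rw [hχ.map_inf ha hb, hfa χ hχ, hgb χ hχ]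
    rfl
  · rintro f ⟨a, ha, hfa⟩ g ⟨b, hb, hgb⟩
    refine ⟨a ⊔ b, ha.sup hb, fun χ hχ => ?_⟩
    rw [hχ.map_sup _ _ ha hb, hfa χ hχ, hgb χ hχ]
    rfl
  · intro v x y
    by_cases hxy : x = y
    · subst hxy
      exact ⟨_, haff (v x) 0, by simp, by simp⟩
    · have hne : (y : ℝ) - x ≠ 0 := sub_ne_zero.2 fun h => hxy (Subtype.ext h.symm)
      refine ⟨_, haff (v x - (v y - v x) / (y - x) * x) ((v y - v x) / (y - x)), ?_, ?_⟩
      · simp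
      · simp only [ContinuousMap.coe_mk]
        field_simp
        ring

/-- The restriction of a homogeneous function to the standard simplex. -/
def Homog.restrict (f : Homog) : C(unitInterval, ℝ) :=
  ⟨fun t => f.1 (1 - t, t), by fun_prop⟩

/-- Krivine's functional calculus exists at any pair of positive elements of an Archimedean vector
lattice which is uniformly complete relative to their sum. -/
theorem exists_isKrivineCalculus {x₀ x₁ : L} (h0 : 0 ≤ x₀) (h1 : 0 ≤ x₁)
    (harch : ∀ x : L, (∀ ε : ℝ, 0 < ε → x ≤ ε • (x₀ + x₁)) → x ≤ 0)
    (hcomp : ∀ s : ℕ → L, (∀ n, |s (n + 1) - s n| ≤ ((1 / 2 : ℝ) ^ n) • (x₀ + x₁)) →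
      ∃ x, ∀ n, |x - s n| ≤ (2 * (1 / 2 : ℝ) ^ n) • (x₀ + x₁)) :
    ∃ τ : Homog →ₗ[ℝ] L, IsKrivineCalculus x₀ x₁ τ := by
  set u := x₀ + x₁ with hu_def
  have hu : 0 ≤ u := add_nonneg h0 h1
  have hub := OrderBounded.self hu
  have hx0 : OrderBounded u x₀ :=
    ⟨1, by rw [one_smul, abs_of_nonneg h0]; exact le_add_of_nonneg_right h1⟩
  have hx1 : OrderBounded u x₁ :=
    ⟨1, by rw [one_smul, abs_of_nonneg h1]; exact le_add_of_nonneg_left h0⟩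
  have huniv := calculusSet_eq_univ hu h1 (le_add_of_nonneg_left h0)
    (isClosed_calculusSet (x₁ := x₁) hu harch hcomp)
  have hex : ∀ f : Homog, ∃ e, OrderBounded u e ∧
      ∀ χ : L → ℝ, IsCharacter u χ → χ e = f.1 (χ x₀, χ x₁) := by
    intro f
    obtain ⟨e, he, heχ⟩ : f.restrict ∈ calculusSet u x₁ := huniv ▸ Set.mem_univ _
    refine ⟨e, he, fun χ hχ => ?_⟩
    -- A character normalized at x₀ + x₁ sees a homogeneous function only on the standard simplex,
    -- so the calculus for functions on [0, 1] suffices.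
    have hs : χ x₀ + χ x₁ = 1 := by rw [← hχ.map_add _ _ hx0 hx1, ← hu_def, hχ.map_unit]
    have h0' : 0 ≤ χ x₀ := by
      rw [← hχ.map_zero]
      exact hχ.mono ⟨0, by simp⟩ hx0 h0
    have h1' : 0 ≤ χ x₁ := by
      rw [← hχ.map_zero]
      exact hχ.mono ⟨0, by simp⟩ hx1 h1
    have hmem : χ x₁ ∈ Set.Icc (0 : ℝ) 1 := ⟨h1', by linarith⟩
    rw [heχ χ hχ, Set.projIcc_of_mem _ hmem]
    change f.1 (1 - χ x₁, χ x₁) = _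
    rw [eq_sub_of_add_eq hs]
  choose τ hτb hτ using hex
  -- Since characters separate the ideal, each algebraic identity for τ follows from the same
  -- identity between real numbers.
  have huniq : ∀ (f : Homog) (e : L), OrderBounded u e →
      (∀ χ : L → ℝ, IsCharacter u χ → χ e = f.1 (χ x₀, χ x₁)) → τ f = e := fun f e he h =>
    le_antisymm
      (le_of_forall_isCharacter hu harch (hτb f) he fun χ hχ => (by rw [h χ hχ, hτ f χ hχ]))
      (le_of_forall_isCharacter hu harch he (hτb f) fun χ hχ => (by rw [h χ hχ, hτ f χ hχ]))
  refine ⟨{ toFun := τ, map_add' := fun f g => ?_, map_smul' := fun c f => ?_ },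
    fun f g => ?_, fun f g => ?_, ?_, ?_⟩
  · refine huniq _ _ ((hτb f).add (hτb g)) fun χ hχ => ?_
    rw [hχ.map_add _ _ (hτb f) (hτb g), hτ f χ hχ, hτ g χ hχ]
    rfl
  · refine huniq _ _ ((hτb f).smul c) fun χ hχ => ?_
    rw [hχ.map_smul _ _ (hτb f), hτ f χ hχ]
    rfl
  · refine huniq _ _ ((hτb f).sup (hτb g)) fun χ hχ => ?_
    refine (hχ.map_sup _ _ (hτb f) (hτb g)).trans ?_
    exact congrArg₂ max (hτ f χ hχ) (hτ g χ hχ)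
  · refine huniq _ _ ((hτb f).inf (hτb g)) fun χ hχ => ?_
    refine (hχ.map_inf (hτb f) (hτb g)).trans ?_
    exact congrArg₂ min (hτ f χ hχ) (hτ g χ hχ)
  · exact huniq _ _ hx0 fun χ hχ => rfl
  · exact huniq _ _ hx1 fun χ hχ => rfl

end Krivine

/-! ### Uniform completeness, ideal embeddings and the Archimedean property. -/

namespace QuasiBanachLattice

variable {E : Type u} [QuasiBanachLattice E]

theorem qnorm_zero : qnorm (0 : E) = 0 := (qnorm_eq_zero_iff 0).2 rfl

theorem qnorm_mono {x y : E} (hx : 0 ≤ x) (hxy : x ≤ y) : qnorm x ≤ qnorm y :=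
  qnorm_le_of_abs_le _ _ (by rwa [abs_of_nonneg hx, abs_of_nonneg (hx.trans hxy)])

theorem qnorm_smul_of_nonneg {c : ℝ} (hc : 0 ≤ c) (x : E) : qnorm (c • x) = c * qnorm x := by
  rw [qnorm_smul, abs_of_nonneg hc]

/-- Order intervals are closed. -/
theorem abs_sub_le_of_tendsto {s : ℕ → E} {x : E}
    (hs : ∀ ε : ℝ, 0 < ε → ∃ N, ∀ n, N ≤ n → qnorm (s n - x) < ε) {y z : E} {m : ℕ}
    (h : ∀ n, m ≤ n → |s n - y| ≤ z) : |x - y| ≤ z := by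
  have h0 : (|x - y| - z) ⊔ 0 = 0 := by
    rw [← qnorm_eq_zero_iff]
    refine le_antisymm (le_of_forall_pos_le_add fun ε hε => ?_) (qnorm_nonneg _)
    obtain ⟨N, hN⟩ := hs ε hε
    refine le_trans ?_ ((hN (max N m) (le_max_left _ _)).le.trans_eq (zero_add ε).symm)
    refine qnorm_le_of_abs_le _ _ ?_
    rw [abs_of_nonneg le_sup_right, abs_sub_comm (s (max N m)) x]
    refine sup_le ?_ (abs_nonneg _)
    rw [sub_le_iff_le_add]
    calc |x - y| = |(x - s (max N m)) + (s (max N m) - y)| := by rw [sub_add_sub_cancel]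
      _ ≤ _ := (abs_add_le _ _).trans (add_le_add le_rfl (h _ (le_max_right _ _)))
  exact sub_nonpos.1 (sup_eq_right.1 h0)

/-- Quasi-Banach lattices are uniformly complete. -/
theorem exists_uniform_limit {u : E} (hu : 0 ≤ u) (s : ℕ → E)
    (hs : ∀ n, |s (n + 1) - s n| ≤ ((1 / 2 : ℝ) ^ n) • u) :
    ∃ x, ∀ n, |x - s n| ≤ (2 * (1 / 2 : ℝ) ^ n) • u := by
  -- Keeping the exact geometric remainder makes the induction on k close.
  have h1 : ∀ n k, |s (n + k) - s n| ≤ (2 * (1 / 2 : ℝ) ^ n - 2 * (1 / 2 : ℝ) ^ (n + k)) • u := by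
    intro n k
    induction k with
    | zero => simp
    | succ k ih =>
      calc |s (n + (k + 1)) - s n| = |(s (n + k + 1) - s (n + k)) + (s (n + k) - s n)| := by
            rw [sub_add_sub_cancel]; rfl
        _ ≤ _ := (abs_add_le _ _).trans (add_le_add (hs _) ih)
        _ = _ := by
          rw [← add_smul]
          congr 1
          rw [← add_assoc n k 1, pow_succ (1 / 2 : ℝ) (n + k)]
          ring
  have h2 : ∀ n m, n ≤ m → |s m - s n| ≤ (2 * (1 / 2 : ℝ) ^ n) • u := by
    intro n m hnm
    obtain ⟨k, rfl⟩ := Nat.exists_eq_add_of_le hnm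
    refine (h1 n k).trans (smul_le_smul_of_nonneg_right ?_ hu)
    have : (0 : ℝ) < (1 / 2 : ℝ) ^ (n + k) := by positivity
    linarith
  obtain ⟨x, hx⟩ := complete s fun ε hε => by
    obtain ⟨N, hN⟩ := exists_pow_lt_of_lt_one
      (show 0 < ε / (4 * (qnorm u + 1)) from div_pos hε (by linarith [qnorm_nonneg u]))
      (show (1 / 2 : ℝ) < 1 by norm_num)
    refine ⟨N, fun m n hm hn => ?_⟩
    have h3 : |s m - s n| ≤ (4 * (1 / 2 : ℝ) ^ N) • u := by
      calc |s m - s n| = |(s m - s N) + (s N - s n)| := by rw [sub_add_sub_cancel]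
        _ ≤ _ := (abs_add_le _ _).trans
          (add_le_add (h2 N m hm) ((abs_sub_comm _ _).trans_le (h2 N n hn)))
        _ = _ := by rw [← add_smul]; congr 1; ring
    have h4 : 0 ≤ 4 * (1 / 2 : ℝ) ^ N := by positivity
    have h5 := qnorm_le_of_abs_le (s m - s n) ((4 * (1 / 2 : ℝ) ^ N) • u)
      (by rwa [abs_of_nonneg (smul_nonneg h4 hu)])
    rw [qnorm_smul_of_nonneg h4] at h5
    have h6 := qnorm_nonneg u
    rw [lt_div_iff₀ (by linarith)] at hN
    have h7 : (0 : ℝ) < (1 / 2 : ℝ) ^ N := by positivity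
    nlinarith
  exact ⟨x, fun n => abs_sub_le_of_tendsto hx (h2 n)⟩

end QuasiBanachLattice

open QuasiBanachLattice

/-- An injective interval preserving lattice homomorphism. -/
structure IsIdealEmbedding {E L : Type*} [AddCommGroup E] [Lattice E] [Module ℝ E]
    [AddCommGroup L] [Lattice L] [Module ℝ L] (ι : E →ₗ[ℝ] L) : Prop where
  injective : Function.Injective ι
  map_sup : ∀ x y, ι (x ⊔ y) = ι x ⊔ ι y
  exists_of_le : ∀ x z, 0 ≤ x → 0 ≤ z → z ≤ ι x → ∃ a, ι a = z

namespace IsIdealEmbedding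

variable {E L : Type*} [AddCommGroup E] [Lattice E] [Module ℝ E] [IsOrderedAddMonoid E]
    [AddCommGroup L] [Lattice L] [Module ℝ L] [IsOrderedAddMonoid L] {ι : E →ₗ[ℝ] L}
    (hι : IsIdealEmbedding ι)
include hι

theorem le_iff {x y : E} : ι x ≤ ι y ↔ x ≤ y := by
  rw [← sup_eq_right, ← hι.map_sup, hι.injective.eq_iff, sup_eq_right]

theorem map_nonneg {x : E} (hx : 0 ≤ x) : 0 ≤ ι x := by
  rw [← map_zero ι]
  exact hι.le_iff.2 hx

theorem map_abs (x : E) : ι |x| = |ι x| := by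
  rw [abs, abs, hι.map_sup, map_neg]

theorem exists_of_abs_le {u : E} {z : L} (hu : 0 ≤ u) (h : |z| ≤ ι u) :
    ∃ a, ι a = z ∧ |a| ≤ u := by
  obtain ⟨a, ha⟩ := hι.exists_of_le u (z ⊔ 0) hu le_sup_right
    (sup_le ((le_abs_self z).trans h) (hι.map_nonneg hu))
  obtain ⟨b, hb⟩ := hι.exists_of_le u (-z ⊔ 0) hu le_sup_right
    (sup_le ((neg_le_abs z).trans h) (hι.map_nonneg hu))
  have hz : ι (a - b) = z := by
    rw [map_sub, ha, hb]
    exact posPart_sub_negPart z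
  exact ⟨a - b, hz, hι.le_iff.1 (by rwa [hι.map_abs, hz])⟩

end IsIdealEmbedding

theorem IsLatticeInclusion.isIdealEmbedding {E : Type u} {X : Type v} [QuasiBanachLattice E]
    [LocallySolidVectorLattice X] {j : E →ₗ[ℝ] X} (hj : IsLatticeInclusion j) :
    IsIdealEmbedding j where
  injective := hj.injective
  map_sup := hj.map_sup
  exists_of_le x z hx h0 h1 := by
    obtain ⟨a, -, ha⟩ : z ∈ j '' Set.Icc 0 x := by
      rw [hj.image_Icc x hx]
      exact ⟨h0, h1⟩
    exact ⟨a, ha⟩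

/-- If x⁺ ≠ 0, the Hausdorff property gives a solid neighbourhood of 0 missing x⁺. It contains εu⁺
for some small ε > 0, and x⁺ ≤ εu⁺ would put x⁺ in it by solidity. -/
theorem LocallySolidVectorLattice.archimedean {X : Type v} [LocallySolidVectorLattice X] (u x : X)
    (h : ∀ ε : ℝ, 0 < ε → x ≤ ε • u) : x ≤ 0 := by
  suffices hz : x ⊔ 0 = 0 from sup_eq_right.1 hz
  by_contra hne
  have hU : {x ⊔ 0}ᶜ ∈ nhds (0 : X) := isOpen_compl_singleton.mem_nhds (Ne.symm hne)
  obtain ⟨V, hV, hVU, hsolid⟩ := LocallySolidVectorLattice.exists_solid_nhds _ hU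
  have ht : Filter.Tendsto (fun ε : ℝ => ε • (u ⊔ 0)) (nhds 0) (nhds (0 : X)) := by
    have : Continuous fun ε : ℝ => ε • (u ⊔ 0) := by fun_prop
    simpa using this.tendsto 0
  obtain ⟨δ, hδ, hball⟩ := Metric.mem_nhds_iff.1 (ht hV)
  have hmem : (δ / 2) • (u ⊔ 0) ∈ V := hball (by
    rw [Metric.mem_ball, dist_zero_right, Real.norm_of_nonneg (by positivity)]; linarith)
  have hle : x ⊔ 0 ≤ (δ / 2) • (u ⊔ 0) :=
    sup_le ((h _ (half_pos hδ)).trans (smul_le_smul_of_nonneg_left le_sup_left (half_pos hδ).le))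
      (smul_nonneg (half_pos hδ).le le_sup_right)
  refine hVU (hsolid hmem (y := x ⊔ 0) ?_) rfl
  rw [abs_of_nonneg le_sup_right, abs_of_nonneg (le_sup_right.trans hle)]
  exact hle

/-! ### Order and quasi-norm of the sum space. -/

namespace CompatiblePair

variable {X₀ : Type u} {X₁ : Type v} [QuasiBanachLattice X₀] [QuasiBanachLattice X₁]
  (P : CompatiblePair.{w} X₀ X₁)

instance : IsOrderedModule ℝ P.Sum where
  smul_le_smul_of_nonneg_left _ hc x y hxy :=
    Subtype.coe_le_coe.1 (smul_le_smul_of_nonneg_left (show (x : P.Ambient) ≤ y from hxy) hc)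
  smul_le_smul_of_nonneg_right x hx _ _ hcd :=
    Subtype.coe_le_coe.1 (smul_le_smul_of_nonneg_right hcd (show (0 : P.Ambient) ≤ x from hx))

theorem isIdealEmbedding₀ : IsIdealEmbedding P.ι₀ where
  injective x y h := P.isLatticeInclusion₀.injective (congrArg Subtype.val h)
  map_sup x y := Subtype.ext (P.isLatticeInclusion₀.map_sup x y)
  exists_of_le x z hx h0 h1 := by
    obtain ⟨a, ha⟩ := P.isLatticeInclusion₀.isIdealEmbedding.exists_of_le x z hx h0 h1
    exact ⟨a, Subtype.ext ha⟩

theorem isIdealEmbedding₁ : IsIdealEmbedding P.ι₁ where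
  injective x y h := P.isLatticeInclusion₁.injective (congrArg Subtype.val h)
  map_sup x y := Subtype.ext (P.isLatticeInclusion₁.map_sup x y)
  exists_of_le x z hx h0 h1 := by
    obtain ⟨a, ha⟩ := P.isLatticeInclusion₁.isIdealEmbedding.exists_of_le x z hx h0 h1
    exact ⟨a, Subtype.ext ha⟩

theorem archimedean (u x : P.Sum) (h : ∀ ε : ℝ, 0 < ε → x ≤ ε • u) : x ≤ 0 :=
  LocallySolidVectorLattice.archimedean (u : P.Ambient) x h

/-- Riesz decomposition splits each increment into pieces dominated by 2^(-n) y₀ and 2^(-n) y₁. The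
two series converge in X₀ and X₁ separately, so completeness of the sum space is not needed. -/
theorem exists_uniform_limit {y₀ : X₀} {y₁ : X₁} (h0 : 0 ≤ y₀) (h1 : 0 ≤ y₁) (s : ℕ → P.Sum)
    (hs : ∀ n, |s (n + 1) - s n| ≤ ((1 / 2 : ℝ) ^ n) • (P.ι₀ y₀ + P.ι₁ y₁)) :
    ∃ x, ∀ n, |x - s n| ≤ (2 * (1 / 2 : ℝ) ^ n) • (P.ι₀ y₀ + P.ι₁ y₁) := by
  have hd : ∀ n, ∃ (a : X₀) (b : X₁), s (n + 1) - s n = P.ι₀ a + P.ι₁ b ∧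
      |a| ≤ ((1 / 2 : ℝ) ^ n) • y₀ ∧ |b| ≤ ((1 / 2 : ℝ) ^ n) • y₁ := by
    intro n
    have hn : (0 : ℝ) ≤ (1 / 2) ^ n := by positivity
    have h0' : 0 ≤ ((1 / 2 : ℝ) ^ n) • y₀ := smul_nonneg hn h0
    have h1' : 0 ≤ ((1 / 2 : ℝ) ^ n) • y₁ := smul_nonneg hn h1
    obtain ⟨p, q, hpq, hp, hq⟩ := exists_riesz_two (Finset.univ : Finset Unit)
      (fun _ => s (n + 1) - s n) (P.ι₀ (((1 / 2 : ℝ) ^ n) • y₀)) (P.ι₁ (((1 / 2 : ℝ) ^ n) • y₁))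
      (P.isIdealEmbedding₀.map_nonneg h0') (P.isIdealEmbedding₁.map_nonneg h1')
      (by simpa [smul_add] using hs n)
    obtain ⟨a, ha, ha'⟩ := P.isIdealEmbedding₀.exists_of_abs_le (z := p ()) h0' (by simpa using hp)
    obtain ⟨b, hb, hb'⟩ := P.isIdealEmbedding₁.exists_of_abs_le (z := q ()) h1' (by simpa using hq)
    exact ⟨a, b, by rw [ha, hb]; exact hpq (), ha', hb'⟩
  choose a b hab ha hb using hd
  obtain ⟨A, hA⟩ := QuasiBanachLattice.exists_uniform_limit h0
    (fun n => ∑ k ∈ Finset.range n, a k) fun n => by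
      rw [Finset.sum_range_succ, add_sub_cancel_left]; exact ha n
  obtain ⟨B, hB⟩ := QuasiBanachLattice.exists_uniform_limit h1
    (fun n => ∑ k ∈ Finset.range n, b k) fun n => by
      rw [Finset.sum_range_succ, add_sub_cancel_left]; exact hb n
  have hsn : ∀ n, s n = s 0 + P.ι₀ (∑ k ∈ Finset.range n, a k) +
      P.ι₁ (∑ k ∈ Finset.range n, b k) := by
    intro n
    induction n with
    | zero => simp
    | succ n ih =>
      rw [Finset.sum_range_succ, Finset.sum_range_succ, map_add, map_add,
        ← sub_add_cancel (s (n + 1)) (s n), hab n]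
      nth_rewrite 1 [ih]
      abel
  refine ⟨s 0 + P.ι₀ A + P.ι₁ B, fun n => ?_⟩
  have e : s 0 + P.ι₀ A + P.ι₁ B - s n = P.ι₀ (A - ∑ k ∈ Finset.range n, a k) +
      P.ι₁ (B - ∑ k ∈ Finset.range n, b k) := by
    rw [hsn n, map_sub, map_sub]
    abel
  rw [e, smul_add, ← map_smul, ← map_smul]
  refine (abs_add_le _ _).trans (add_le_add ?_ ?_)
  · rw [← P.isIdealEmbedding₀.map_abs]
    exact P.isIdealEmbedding₀.le_iff.2 (hA n)
  · rw [← P.isIdealEmbedding₁.map_abs]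
    exact P.isIdealEmbedding₁.le_iff.2 (hB n)

theorem exists_isKrivineCalculus {y₀ : X₀} {y₁ : X₁} (h0 : 0 ≤ y₀) (h1 : 0 ≤ y₁) :
    ∃ τ : Homog →ₗ[ℝ] P.Sum, IsKrivineCalculus (P.ι₀ y₀) (P.ι₁ y₁) τ :=
  CalderonLozanovskii.exists_isKrivineCalculus (P.isIdealEmbedding₀.map_nonneg h0)
    (P.isIdealEmbedding₁.map_nonneg h1) (P.archimedean _) (P.exists_uniform_limit h0 h1)

theorem sumNorm_le {x : P.Sum} {a : X₀} {b : X₁} (h : x = P.ι₀ a + P.ι₁ b) :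
    P.sumNorm x ≤ qnorm a + qnorm b :=
  csInf_le ⟨0, by rintro r ⟨a, b, -, rfl⟩; exact add_nonneg (qnorm_nonneg _) (qnorm_nonneg _)⟩
    ⟨a, b, h, rfl⟩

theorem exists_decomposition (x : P.Sum) : ∃ (a : X₀) (b : X₁), x = P.ι₀ a + P.ι₁ b := by
  obtain ⟨_, ⟨a, ha⟩, _, ⟨b, hb⟩, hab⟩ := Submodule.mem_sup.1 x.2
  exact ⟨a, b, Subtype.ext (by rw [← hab, ← ha, ← hb]; rfl)⟩

theorem exists_decomposition_lt {x : P.Sum} {r : ℝ} (hr : P.sumNorm x < r) :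
    ∃ (a : X₀) (b : X₁), x = P.ι₀ a + P.ι₁ b ∧ qnorm a + qnorm b < r := by
  obtain ⟨a, b, hab⟩ := P.exists_decomposition x
  obtain ⟨_, ⟨a', b', hab', rfl⟩, hlt⟩ := exists_lt_of_csInf_lt (by exact ⟨_, a, b, hab, rfl⟩) hr
  exact ⟨a', b', hab', hlt⟩

theorem sumNorm_mono {x y : P.Sum} (h : |x| ≤ |y|) : P.sumNorm x ≤ P.sumNorm y := by
  refine le_of_forall_pos_le_add fun ε hε => ?_
  obtain ⟨a, b, hab, hlt⟩ := P.exists_decomposition_lt (lt_add_of_pos_right (P.sumNorm y) hε)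
  obtain ⟨p, q, hpq, hp, hq⟩ := exists_riesz_two (Finset.univ : Finset Unit)
    (fun _ => x) (P.ι₀ |a|) (P.ι₁ |b|)
    (P.isIdealEmbedding₀.map_nonneg (abs_nonneg a)) (P.isIdealEmbedding₁.map_nonneg (abs_nonneg b))
    (by
      rw [P.isIdealEmbedding₀.map_abs, P.isIdealEmbedding₁.map_abs]
      simpa using (h.trans_eq (by rw [hab])).trans (abs_add_le _ _))
  obtain ⟨a', ha, ha'⟩ := P.isIdealEmbedding₀.exists_of_abs_le (z := p ()) (abs_nonneg a)
    (by simpa using hp)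
  obtain ⟨b', hb, hb'⟩ := P.isIdealEmbedding₁.exists_of_abs_le (z := q ()) (abs_nonneg b)
    (by simpa using hq)
  have h1 := P.sumNorm_le (x := x) (a := a') (b := b') (by rw [ha, hb]; exact hpq ())
  have h2 := qnorm_le_of_abs_le a' a ha'
  have h3 := qnorm_le_of_abs_le b' b hb'
  linarith

theorem sumNorm_smul_le (c : ℝ) (x : P.Sum) : P.sumNorm (c • x) ≤ |c| * P.sumNorm x := by
  have h1 : ∀ r, P.sumNorm x < r → P.sumNorm (c • x) ≤ |c| * r := by
    intro r hr
    obtain ⟨a, b, hab, hlt⟩ := P.exists_decomposition_lt hr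
    refine (P.sumNorm_le (a := c • a) (b := c • b) (by rw [hab]; simp)).trans ?_
    rw [qnorm_smul, qnorm_smul, ← mul_add]
    exact mul_le_mul_of_nonneg_left hlt.le (abs_nonneg c)
  refine le_of_forall_pos_le_add fun ε hε => ?_
  refine (h1 (P.sumNorm x + ε / (|c| + 1)) (by linarith [div_pos hε (show 0 < |c| + 1 by
    positivity)])).trans ?_
  rw [mul_add]
  have : |c| * (ε / (|c| + 1)) ≤ ε := by
    rw [mul_div_assoc', div_le_iff₀ (by positivity)]
    nlinarith [abs_nonneg c]
  linarith

theorem exists_sumNorm_add_le : ∃ C : ℝ, 1 ≤ C ∧ ∀ x y : P.Sum,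
    P.sumNorm (x + y) ≤ C * (P.sumNorm x + P.sumNorm y) := by
  obtain ⟨C₀, hC₀, h0⟩ := exists_qnorm_add_le (E := X₀)
  obtain ⟨C₁, hC₁, h1⟩ := exists_qnorm_add_le (E := X₁)
  refine ⟨max C₀ C₁, hC₀.trans (le_max_left _ _), fun x y => ?_⟩
  refine le_of_forall_pos_le_add fun ε hε => ?_
  have hC : 0 < max C₀ C₁ := zero_lt_one.trans_le (hC₀.trans (le_max_left _ _))
  set δ := ε / (2 * max C₀ C₁) with hδ
  have hδ0 : 0 < δ := by positivity
  have hδε : max C₀ C₁ * (δ + δ) = ε := by rw [hδ]; field_simp; ring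
  obtain ⟨a, b, hab, hlt⟩ := P.exists_decomposition_lt (lt_add_of_pos_right (P.sumNorm x) hδ0)
  obtain ⟨a', b', hab', hlt'⟩ := P.exists_decomposition_lt (lt_add_of_pos_right (P.sumNorm y) hδ0)
  refine (P.sumNorm_le (a := a + a') (b := b + b') (by
    rw [hab, hab', map_add, map_add]; abel)).trans ?_
  have e0 : qnorm (a + a') ≤ max C₀ C₁ * (qnorm a + qnorm a') := (h0 a a').trans
    (mul_le_mul_of_nonneg_right (le_max_left _ _) (add_nonneg (qnorm_nonneg _) (qnorm_nonneg _)))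
  have e1 : qnorm (b + b') ≤ max C₀ C₁ * (qnorm b + qnorm b') := (h1 b b').trans
    (mul_le_mul_of_nonneg_right (le_max_right _ _) (add_nonneg (qnorm_nonneg _) (qnorm_nonneg _)))
  nlinarith

end CompatiblePair

/-! ### Greedy selection of exponents with geometric growth and decay. -/

section Selection

/-- Split off the largest index a: all other values are at most v a / 2, so by induction they sum to
at most v a. -/
theorem sum_le_of_doubling (S : Finset ℤ) (v : ℤ → ℝ)
    (hsep : ∀ e ∈ S, ∀ e' ∈ S, e < e' → 2 * v e ≤ v e') {M : ℝ} (hM : 0 ≤ M)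
    (hv : ∀ e ∈ S, v e ≤ M) (h0 : ∀ e, 0 ≤ v e) : ∑ e ∈ S, v e ≤ 2 * M := by
  induction S using Finset.induction_on_max generalizing M with
  | empty => simpa using hM
  | insert a s ha ih =>
    have hna : a ∉ s := fun h => lt_irrefl _ (ha a h)
    rw [Finset.sum_insert hna]
    have h1 := ih (fun e he e' he' => hsep e (Finset.mem_insert_of_mem he) e'
      (Finset.mem_insert_of_mem he')) (M := v a / 2) (by linarith [h0 a]) fun e he => by
        linarith [hsep e (Finset.mem_insert_of_mem he) a (Finset.mem_insert_self _ _) (ha e he)]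
    linarith [hv a (Finset.mem_insert_self _ _)]

theorem sum_le_of_halving (S : Finset ℤ) (v : ℤ → ℝ)
    (hsep : ∀ e ∈ S, ∀ e' ∈ S, e < e' → 2 * v e' ≤ v e) {M : ℝ} (hM : 0 ≤ M)
    (hv : ∀ e ∈ S, v e ≤ M) (h0 : ∀ e, 0 ≤ v e) : ∑ e ∈ S, v e ≤ 2 * M := by
  induction S using Finset.induction_on_min generalizing M with
  | empty => simpa using hM
  | insert a s ha ih =>
    have hna : a ∉ s := fun h => lt_irrefl _ (ha a h)
    rw [Finset.sum_insert hna]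
    have h1 := ih (fun e he e' he' => hsep e (Finset.mem_insert_of_mem he) e'
      (Finset.mem_insert_of_mem he')) (M := v a / 2) (by linarith [h0 a]) fun e he => by
        linarith [hsep a (Finset.mem_insert_self _ _) e (Finset.mem_insert_of_mem he) (ha e he)]
    linarith [hv a (Finset.mem_insert_self _ _)]

/-- The index `j` is represented by the index `e`. -/
def Represents (ρ σ : ℤ → ℝ) (e j : ℤ) : Prop :=
  (e ≤ j ∧ ρ j ≤ 4 * ρ e) ∨ (j ≤ e ∧ σ j ≤ 4 * σ e)

/-- The set of indices `S` is such that `ρ` grows and `σ` decays geometrically on `S`. -/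
def Separated (ρ σ : ℤ → ℝ) (S : Finset ℤ) : Prop :=
  ∀ e ∈ S, ∀ e' ∈ S, e < e' → 2 * ρ e ≤ ρ e' ∧ 2 * σ e' ≤ σ e

theorem exists_separated {ρ σ : ℤ → ℝ} (hρ0 : ∀ j, 0 ≤ ρ j) (hσ0 : ∀ j, 0 ≤ σ j)
    (hρ : Monotone ρ) (hσ : Antitone σ)
    (hσ2 : ∀ j, σ j ≤ 2 * σ (j + 1)) (a : ℤ) (n : ℕ) :
    ∃ S : Finset ℤ, Separated ρ σ S ∧
      ∀ j, a ≤ j → j ≤ a + n → ∃ e ∈ insert (a + n) S, Represents ρ σ e j := by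
  -- Here k is the last exponent selected. The final disjunction says that since k either ρ has not
  -- more than doubled or σ has not dropped below half; a new exponent is selected as soon as both
  -- fail. The endpoint a + n may have to represent a tail through σ without being selected, hence
  -- the extra index in the conclusion.
  suffices h : ∃ (S : Finset ℤ) (k : ℤ), k ∈ S ∧ k ≤ a + n ∧ (∀ e ∈ S, e ≤ k) ∧ Separated ρ σ S ∧
      (∀ j, a ≤ j → j ≤ k → ∃ e ∈ S, Represents ρ σ e j) ∧
      (ρ (a + n) ≤ 2 * ρ k ∨ σ k ≤ 2 * σ (a + n)) by
    obtain ⟨S, k, hkS, hk, -, hsep, hrep, hun⟩ := h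
    refine ⟨S, hsep, fun j haj hj => ?_⟩
    rcases le_total j k with hjk | hjk
    · obtain ⟨e, he, h⟩ := hrep j haj hjk
      exact ⟨e, Finset.mem_insert_of_mem he, h⟩
    · rcases hun with h | h
      · exact ⟨k, Finset.mem_insert_of_mem hkS, Or.inl ⟨hjk, by linarith [hρ hj, hρ0 k]⟩⟩
      · exact ⟨a + n, Finset.mem_insert_self _ _, Or.inr ⟨hj, by linarith [hσ hjk, hσ0 (a + n)]⟩⟩
  induction n with
  | zero =>
    refine ⟨{a}, a, by simp, by simp, by simp, ?_, ?_, Or.inl ?_⟩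
    · intro e he e' he' h
      rw [Finset.mem_singleton] at he he'
      omega
    · intro j h1 h2
      obtain rfl : j = a := le_antisymm h2 h1
      exact ⟨j, by simp, Or.inl ⟨le_rfl, by linarith [hρ0 j]⟩⟩
    · simpa using (by linarith [hρ0 a] : ρ a ≤ 2 * ρ a)
  | succ n ih =>
    obtain ⟨S, k, hkS, hk, hmax, hsep, hrep, hun⟩ := ih
    have hcast : a + ((n + 1 : ℕ) : ℤ) = a + n + 1 := by push_cast; ring
    rw [hcast]
    generalize a + (n : ℤ) = b at *
    by_cases hc : ρ (b + 1) ≤ 2 * ρ k ∨ σ k ≤ 2 * σ (b + 1)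
    · exact ⟨S, k, hkS, by omega, hmax, hsep, hrep, hc⟩
    rw [not_or, not_le, not_le] at hc
    refine ⟨insert (b + 1) S, b + 1, Finset.mem_insert_self _ _, le_rfl, ?_, ?_, ?_,
      Or.inl (by linarith [hρ0 (b + 1)])⟩
    · intro e he
      rcases Finset.mem_insert.1 he with rfl | he
      · exact le_rfl
      · linarith [hmax e he]
    · intro e he e' he' hlt
      rcases Finset.mem_insert.1 he with rfl | he
      · rcases Finset.mem_insert.1 he' with rfl | he'
        · omega
        · have := hmax e' he'
          omega
      · rcases Finset.mem_insert.1 he' with rfl | he'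
        · exact ⟨by linarith [hρ (hmax e he)], by linarith [hσ (hmax e he)]⟩
        · exact hsep e he e' he' hlt
    · intro j haj hj
      rcases le_total j k with hjk | hjk
      · obtain ⟨e, he, h⟩ := hrep j haj hjk
        exact ⟨e, Finset.mem_insert_of_mem he, h⟩
      rcases hj.eq_or_lt with rfl | hj
      · exact ⟨b + 1, Finset.mem_insert_self _ _, Or.inl ⟨le_rfl, by linarith [hρ0 (b + 1)]⟩⟩
      have hjb : j ≤ b := by omega
      -- An index skipped between k and b is represented by k through ρ, or else by the new exponent
      -- b + 1 through σ. In the second case one factor 2 comes from the invariant and another from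
      -- the step b to b + 1, giving 4.
      rcases hun with h | h
      · exact ⟨k, Finset.mem_insert_of_mem hkS, Or.inl ⟨hjk, by linarith [hρ hjb, hρ0 k]⟩⟩
      · exact ⟨b + 1, Finset.mem_insert_self _ _,
          Or.inr ⟨by omega, by linarith [hσ hjk, hσ2 b]⟩⟩

end Selection

/-! ### Homogeneous functions: sparse dyadic sums and bump functions. -/

namespace Homog

/-- Evaluation at a point, as a linear map. -/
def eval (p : ℝ × ℝ) : Homog →ₗ[ℝ] ℝ where
  toFun f := f.1 p
  map_add' _ _ := rfl
  map_smul' _ _ := rfl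

theorem le_iff {f g : Homog} : f ≤ g ↔ ∀ p, eval p f ≤ eval p g := Iff.rfl

theorem eval_smul_point {c : ℝ} (hc : 0 ≤ c) (s t : ℝ) (f : Homog) :
    eval (c * s, c * t) f = c * eval (s, t) f := f.2 c (s, t) hc

/-- The positive part of the first coordinate. -/
noncomputable def fstPos : Homog := fst ⊔ 0

/-- The positive part of the second coordinate. -/
noncomputable def sndPos : Homog := snd ⊔ 0

theorem eval_fstPos (p : ℝ × ℝ) : eval p fstPos = max p.1 0 := rfl

theorem eval_sndPos (p : ℝ × ℝ) : eval p sndPos = max p.2 0 := rfl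

/-- `f` is nonnegative, non-decreasing in each variable, and determined by its values on the
closed quadrant. -/
structure IsMono (f : Homog) : Prop where
  nonneg : ∀ p, 0 ≤ eval p f
  mono : ∀ s s' t t', s ≤ s' → t ≤ t' → eval (s, t) f ≤ eval (s', t') f
  eval_max : ∀ s t, eval (max s 0, max t 0) f = eval (s, t) f

/-- The values at the dyadic points. -/
noncomputable def dyadic (f : Homog) (j : ℤ) : ℝ := eval (1, 2 ^ j) f

theorem smul_dyadic {c : ℝ} (hc : 0 ≤ c) (f : Homog) (j : ℤ) :
    c * f.dyadic j = eval (c, c * 2 ^ j) f := by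
  rw [dyadic, ← eval_smul_point hc, mul_one]

theorem dyadic_mul_eq (f : Homog) (j : ℤ) : f.dyadic j * 2 ^ (-j) = eval (2 ^ (-j), 1) f := by
  rw [mul_comm, smul_dyadic (by positivity), ← zpow_add₀ two_ne_zero, neg_add_cancel, zpow_zero]

namespace IsMono

variable {f : Homog} (hf : f.IsMono)
include hf

theorem dyadic_nonneg (j : ℤ) : 0 ≤ f.dyadic j := hf.nonneg _

theorem dyadic_mono : Monotone f.dyadic := fun _ _ h =>
  hf.mono _ _ _ _ le_rfl (zpow_le_zpow_right₀ one_le_two h)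

theorem exists_separated (a : ℤ) (n : ℕ) :
    ∃ S : Finset ℤ, Separated f.dyadic (fun j => f.dyadic j * 2 ^ (-j)) S ∧
      ∀ j, a ≤ j → j ≤ a + n →
        ∃ e ∈ insert (a + n) S, Represents f.dyadic (fun j => f.dyadic j * 2 ^ (-j)) e j := by
  refine CalderonLozanovskii.exists_separated hf.dyadic_nonneg
    (fun j => mul_nonneg (hf.dyadic_nonneg j) (by positivity)) hf.dyadic_mono ?_ ?_ a n
  · intro i j h
    simp only [dyadic_mul_eq]
    exact hf.mono _ _ _ _ (zpow_le_zpow_right₀ one_le_two (neg_le_neg h)) le_rfl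
  · intro j
    have h1 := hf.dyadic_mono (show j ≤ j + 1 by omega)
    have h2 : (2 : ℝ) ^ (-(j + 1)) * 2 = 2 ^ (-j) := by
      rw [← zpow_add_one₀ two_ne_zero, neg_add, neg_add_cancel_right]
    have h3 : (0 : ℝ) < 2 ^ (-(j + 1)) := by positivity
    change f.dyadic j * 2 ^ (-j) ≤ 2 * (f.dyadic (j + 1) * 2 ^ (-(j + 1)))
    rw [← h2]
    nlinarith

/-- Split S at 2^e s ≤ t. On the lower part the minimum is bounded by s, and the terms ρ_e s double
while staying below f(s, t); on the upper part it is bounded by 2^(-e) t, and the terms σ_e t halve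
while staying below f(s, t). Each part costs 2 f(s, t), and the extra index b at most one more. -/
theorem sum_dyadic_mul_min_le {S : Finset ℤ} (b : ℤ)
    (hS : Separated f.dyadic (fun j => f.dyadic j * 2 ^ (-j)) S) {s t : ℝ} (hs : 0 ≤ s)
    (ht : 0 ≤ t) : ∑ e ∈ insert b S, f.dyadic e * min s (2 ^ (-e) * t) ≤ 5 * eval (s, t) f := by
  have hterm : ∀ e, f.dyadic e * min s (2 ^ (-e) * t) ≤ eval (s, t) f := by
    intro e
    rw [mul_comm, smul_dyadic (le_min hs (by positivity))]
    refine hf.mono _ _ _ _ (min_le_left _ _) ?_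
    calc min s (2 ^ (-e) * t) * 2 ^ e ≤ (2 ^ (-e) * t) * 2 ^ e :=
          mul_le_mul_of_nonneg_right (min_le_right _ _) (by positivity)
      _ = t := by
        rw [mul_right_comm, ← zpow_add₀ two_ne_zero, neg_add_cancel, zpow_zero, one_mul]
  have hM : 0 ≤ eval (s, t) f := hf.nonneg _
  have hsum : ∑ e ∈ S, f.dyadic e * min s (2 ^ (-e) * t) ≤ 4 * eval (s, t) f := by
    rw [← Finset.sum_filter_add_sum_filter_not S (fun e => s * 2 ^ e ≤ t)]
    have h1 : ∑ e ∈ S with s * 2 ^ e ≤ t, f.dyadic e * s ≤ 2 * eval (s, t) f := by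
      refine sum_le_of_doubling _ _ (fun e he e' he' h => ?_) hM (fun e he => ?_)
        fun e => mul_nonneg (hf.dyadic_nonneg e) hs
      · have := (hS e (Finset.mem_filter.1 he).1 e' (Finset.mem_filter.1 he').1 h).1
        nlinarith
      · rw [mul_comm, smul_dyadic hs]
        exact hf.mono _ _ _ _ le_rfl (Finset.mem_filter.1 he).2
    have h2 : ∑ e ∈ S with ¬ s * 2 ^ e ≤ t, f.dyadic e * 2 ^ (-e) * t ≤ 2 * eval (s, t) f := by
      refine sum_le_of_halving _ _ (fun e he e' he' h => ?_) hM (fun e he => ?_)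
        fun e => mul_nonneg (mul_nonneg (hf.dyadic_nonneg e) (by positivity)) ht
      · have := (hS e (Finset.mem_filter.1 he).1 e' (Finset.mem_filter.1 he').1 h).2
        simp only at this
        nlinarith
      · rw [dyadic_mul_eq, mul_comm, ← eval_smul_point ht, mul_one]
        refine hf.mono _ _ _ _ ?_ le_rfl
        have h3 := not_le.1 (Finset.mem_filter.1 he).2
        rw [zpow_neg, ← div_eq_mul_inv, div_le_iff₀ (by positivity)]
        exact h3.le
    have h3 : ∑ e ∈ S with s * 2 ^ e ≤ t, f.dyadic e * min s (2 ^ (-e) * t) ≤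
        ∑ e ∈ S with s * 2 ^ e ≤ t, f.dyadic e * s := Finset.sum_le_sum fun e _ =>
      mul_le_mul_of_nonneg_left (min_le_left _ _) (hf.dyadic_nonneg e)
    have h4 : ∑ e ∈ S with ¬ s * 2 ^ e ≤ t, f.dyadic e * min s (2 ^ (-e) * t) ≤
        ∑ e ∈ S with ¬ s * 2 ^ e ≤ t, f.dyadic e * 2 ^ (-e) * t := Finset.sum_le_sum fun e _ => by
      rw [mul_assoc]
      exact mul_le_mul_of_nonneg_left (min_le_right _ _) (hf.dyadic_nonneg e)
    linarith
  by_cases hb : b ∈ S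
  · rw [Finset.insert_eq_of_mem hb]
    linarith
  · rw [Finset.sum_insert hb]
    linarith [hterm b]

end IsMono

/-- A bump function concentrated around the ray `t = 2 ^ j s`. -/
noncomputable def bump (j : ℤ) : Homog :=
  (fstPos ⊓ (2 ^ (-j) : ℝ) • sndPos - fstPos ⊓ (2 ^ (-(j + 1)) : ℝ) • sndPos) ⊓
    (2 ^ (-j) : ℝ) • (sndPos ⊓ (2 ^ j : ℝ) • fstPos - sndPos ⊓ (2 ^ (j - 1) : ℝ) • fstPos)

theorem eval_bump (j : ℤ) (p : ℝ × ℝ) : eval p (bump j) =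
    min (min (max p.1 0) (2 ^ (-j) * max p.2 0) - min (max p.1 0) (2 ^ (-(j + 1)) * max p.2 0))
      (2 ^ (-j) * (min (max p.2 0) (2 ^ j * max p.1 0) -
        min (max p.2 0) (2 ^ (j - 1) * max p.1 0))) := rfl

theorem bump_nonneg (j : ℤ) : 0 ≤ bump j := by
  rw [le_iff]
  intro p
  rw [eval_bump, map_zero]
  refine le_min (sub_nonneg.2 (min_le_min le_rfl ?_))
    (mul_nonneg (by positivity) (sub_nonneg.2 (min_le_min le_rfl ?_)))
  · exact mul_le_mul_of_nonneg_right (zpow_le_zpow_right₀ one_le_two (by omega))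
      (le_max_right _ _)
  · exact mul_le_mul_of_nonneg_right (zpow_le_zpow_right₀ one_le_two (by omega))
      (le_max_right _ _)

/-- The first member of the minimum defining the bump is a difference of consecutive truncations of
s, so the sum telescopes. The second member, multiplied by 2^j, plays the same role for t in
`sum_smul_bump_le`. -/
theorem sum_bump_le (a : ℤ) (N : ℕ) : ∑ n ∈ Finset.range N, bump (a + n) ≤ fstPos := by
  rw [le_iff]
  intro p
  rw [map_sum, eval_fstPos]
  set g : ℕ → ℝ := fun n => min (max p.1 0) (2 ^ (-(a + n)) * max p.2 0) with hg
  have h1 : ∀ n ∈ Finset.range N, eval p (bump (a + n)) ≤ g n - g (n + 1) := by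
    intro n _
    rw [eval_bump]
    refine (min_le_left _ _).trans_eq ?_
    simp only [hg]
    push_cast
    rw [add_assoc]
  refine (Finset.sum_le_sum h1).trans ?_
  rw [Finset.sum_range_sub']
  have h2 : g 0 ≤ max p.1 0 := min_le_left _ _
  have h3 : 0 ≤ g N := le_min (le_max_right _ _) (mul_nonneg (by positivity) (le_max_right _ _))
  linarith

theorem sum_smul_bump_le (a : ℤ) (N : ℕ) :
    ∑ n ∈ Finset.range N, (2 ^ (a + n) : ℝ) • bump (a + n) ≤ sndPos := by
  rw [le_iff]
  intro p
  rw [map_sum, eval_sndPos]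
  set g : ℕ → ℝ := fun n => min (max p.2 0) (2 ^ (a + n - 1) * max p.1 0) with hg
  have h1 : ∀ n ∈ Finset.range N,
      eval p ((2 ^ (a + n) : ℝ) • bump (a + n)) ≤ g (n + 1) - g n := by
    intro n _
    rw [map_smul, eval_bump, smul_eq_mul]
    refine (mul_le_mul_of_nonneg_left (min_le_right _ _) (by positivity)).trans_eq ?_
    rw [← mul_assoc, ← zpow_add₀ two_ne_zero, add_neg_cancel, zpow_zero, one_mul]
    simp only [hg]
    push_cast
    rw [← add_assoc, add_sub_cancel_right]
  refine (Finset.sum_le_sum h1).trans ?_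
  rw [Finset.sum_range_sub]
  have h2 : g N ≤ max p.2 0 := min_le_left _ _
  have h3 : 0 ≤ g 0 := le_min (le_max_right _ _) (mul_nonneg (by positivity) (le_max_right _ _))
  linarith

/-- With t = 2^i q and s ≤ q ≤ 2s, the two bumps are s - q/2 and (q - s)/2, whose sum is exactly
s/2. -/
theorem half_le_eval_bump_add {i : ℤ} {s t : ℝ} (h1 : 2 ^ i * s ≤ t) (h2 : t ≤ 2 ^ (i + 1) * s)
    (hs : 0 ≤ s) : s / 2 ≤ eval (s, t) (bump i) + eval (s, t) (bump (i + 1)) := by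
  have hpos : (0 : ℝ) < 2 ^ i := by positivity
  have ht : 0 ≤ t := h1.trans' (by positivity)
  obtain ⟨q, rfl⟩ : ∃ q, t = 2 ^ i * q := ⟨t / 2 ^ i, by field_simp⟩
  have e1 : (2 : ℝ) ^ (i + 1) = 2 ^ i * 2 := by rw [zpow_add₀ two_ne_zero, zpow_one]
  have hq1 : s ≤ q := le_of_mul_le_mul_left h1 hpos
  have hq2 : q ≤ 2 * s := by
    rw [e1, mul_assoc] at h2
    exact le_of_mul_le_mul_left h2 hpos
  have e2 : (2 : ℝ) ^ (-i) = (2 ^ i)⁻¹ := zpow_neg _ _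
  have e3 : (2 : ℝ) ^ (-(i + 1)) = (2 ^ i)⁻¹ * 2⁻¹ := by rw [zpow_neg, e1, mul_inv]
  have e4 : (2 : ℝ) ^ (-(i + 1 + 1)) = (2 ^ i)⁻¹ * 4⁻¹ := by
    rw [zpow_neg, zpow_add₀ two_ne_zero, e1, zpow_one, mul_assoc, mul_inv]; norm_num
  have e5 : (2 : ℝ) ^ (i - 1) = 2 ^ i * 2⁻¹ := by rw [zpow_sub₀ two_ne_zero, zpow_one]; rfl
  rw [eval_bump, eval_bump, add_sub_cancel_right]
  simp only [max_eq_left hs, max_eq_left ht, e1, e2, e3, e4, e5]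
  generalize (2 : ℝ) ^ i = c at *
  have f1 : c⁻¹ * (c * q) = q := by field_simp
  have f2 : c⁻¹ * 2⁻¹ * (c * q) = q / 2 := by field_simp
  have f3 : c⁻¹ * 4⁻¹ * (c * q) = q / 4 := by field_simp
  have g1 : min (c * q) (c * s) = c * s := min_eq_right h1
  have g2 : min (c * q) (c * 2⁻¹ * s) = c * s / 2 := by
    rw [min_eq_right] <;> nlinarith
  have g3 : min (c * q) (c * 2 * s) = c * q := min_eq_left (by nlinarith)
  rw [f1, f2, f3, g1, g2, g3, min_eq_left hq1, min_eq_right (by linarith : q / 2 ≤ s),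
    min_eq_right (by linarith : q / 4 ≤ s)]
  have k1 : c⁻¹ * (c * s - c * s / 2) = s / 2 := by field_simp; ring
  have k2 : c⁻¹ * 2⁻¹ * (c * q - c * s) = q / 2 - s / 2 := by field_simp
  rw [k1, k2]
  rcases min_cases (s - q / 2) (s / 2) with h | h <;>
    rcases min_cases (q / 2 - q / 4) (q / 2 - s / 2) with h' | h' <;> linarith

theorem IsMono.smul_fstPos_le {f : Homog} (hf : f.IsMono) : eval (1, 0) f • fstPos ≤ f := by
  rw [le_iff]
  rintro ⟨s, t⟩
  rw [map_smul, eval_fstPos, smul_eq_mul, mul_comm, ← eval_smul_point (le_max_right _ _),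
    ← hf.eval_max s t, mul_one, mul_zero]
  exact hf.mono _ _ _ _ le_rfl (le_max_right _ _)

theorem IsMono.smul_sndPos_le {f : Homog} (hf : f.IsMono) : eval (0, 1) f • sndPos ≤ f := by
  rw [le_iff]
  rintro ⟨s, t⟩
  rw [map_smul, eval_sndPos, smul_eq_mul, mul_comm, ← eval_smul_point (le_max_right _ _),
    ← hf.eval_max s t, mul_one, mul_zero]
  exact hf.mono _ _ _ _ (le_max_right _ _) le_rfl

theorem IsMono.sum_dyadic_smul_le {f : Homog} (hf : f.IsMono) {S : Finset ℤ} (b : ℤ)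
    (hS : Separated f.dyadic (fun j => f.dyadic j * 2 ^ (-j)) S) :
    ∑ e ∈ insert b S, f.dyadic e • (fstPos ⊓ (2 ^ (-e) : ℝ) • sndPos) ≤ (5 : ℝ) • f := by
  rw [le_iff]
  rintro ⟨s, t⟩
  rw [map_sum, map_smul, ← hf.eval_max s t]
  exact hf.sum_dyadic_mul_min_le b hS (le_max_right s 0) (le_max_right t 0)

/-- Continuity at (1, 0) and (0, 1). Beyond the dyadic window the function is then controlled by its
boundary values, up to δ. -/
theorem exists_grid (f : Homog) {δ : ℝ} (hδ : 0 < δ) : ∃ J₀ : ℕ, ∀ J : ℕ, J₀ ≤ J →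
    eval (1, 2 ^ (-(J : ℤ))) f ≤ eval (1, 0) f + δ ∧
    eval (2 ^ (-(J : ℤ)), 1) f ≤ eval (0, 1) f + δ := by
  have ht : Filter.Tendsto (fun J : ℕ => (2 : ℝ) ^ (-(J : ℤ))) Filter.atTop (nhds 0) := by
    have := tendsto_pow_atTop_nhds_zero_of_lt_one (r := (2⁻¹ : ℝ)) (by norm_num) (by norm_num)
    refine this.congr fun n => ?_
    rw [zpow_neg, zpow_natCast, inv_pow]
  have h1 : Filter.Tendsto (fun J : ℕ => f.1 (1, (2 : ℝ) ^ (-(J : ℤ)))) Filter.atTop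
      (nhds (f.1 (1, 0))) :=
    (f.1.continuous.tendsto _).comp (tendsto_const_nhds.prodMk_nhds ht)
  have h2 : Filter.Tendsto (fun J : ℕ => f.1 ((2 : ℝ) ^ (-(J : ℤ)), 1)) Filter.atTop
      (nhds (f.1 (0, 1))) :=
    (f.1.continuous.tendsto _).comp (ht.prodMk_nhds tendsto_const_nhds)
  have h3 := (h1.eventually_le_const (lt_add_of_pos_right _ hδ)).and
    (h2.eventually_le_const (lt_add_of_pos_right _ hδ))
  exact Filter.eventually_atTop.1 h3

/-- Near each axis, outside the rays t = 2^(∓J) s, the boundary terms dominate by monotonicity. In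
between, two neighbouring bumps suffice. -/
theorem IsMono.le_sum_bump {f : Homog} (hf : f.IsMono) {δ : ℝ} (hδ : 0 < δ) {J : ℕ}
    (h1 : eval (1, 2 ^ (-(J : ℤ))) f ≤ eval (1, 0) f + δ)
    (h2 : eval (2 ^ (-(J : ℤ)), 1) f ≤ eval (0, 1) f + δ) :
    f ≤ (4 : ℝ) • ∑ n ∈ Finset.range (2 * J + 1), f.dyadic (-J + n) • bump (-J + n) +
      ((eval (1, 0) f + δ) • fstPos + (eval (0, 1) f + δ) • sndPos) := by
  rw [le_iff]
  rintro ⟨s', t'⟩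
  rw [map_add, map_add, map_smul, map_smul, map_smul, map_sum, eval_fstPos, eval_sndPos,
    ← hf.eval_max s' t', smul_eq_mul, smul_eq_mul, smul_eq_mul]
  simp only [map_smul, smul_eq_mul]
  have hb : ∀ j, eval (s', t') (bump j) = eval (max s' 0, max t' 0) (bump j) := fun j => by
    simp only [eval_bump, max_eq_left (le_max_right s' 0), max_eq_left (le_max_right t' 0)]
  simp only [hb]
  have hs : 0 ≤ max s' 0 := le_max_right _ _
  have ht : 0 ≤ max t' 0 := le_max_right _ _
  generalize max s' 0 = s at *
  generalize max t' 0 = t at *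
  have hnn : ∀ j, 0 ≤ f.dyadic j * eval (s, t) (bump j) := fun j =>
    mul_nonneg (hf.dyadic_nonneg j) (by simpa using le_iff.1 (bump_nonneg j) (s, t))
  have hsum : 0 ≤ ∑ n ∈ Finset.range (2 * J + 1),
      f.dyadic (-J + n) * eval (s, t) (bump (-J + n)) := Finset.sum_nonneg fun n _ => hnn _
  have hα : 0 ≤ (eval (1, 0) f + δ) * s := mul_nonneg (add_nonneg (hf.nonneg _) hδ.le) hs
  have hβ : 0 ≤ (eval (0, 1) f + δ) * t := mul_nonneg (add_nonneg (hf.nonneg _) hδ.le) ht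
  by_cases hc1 : t ≤ s * 2 ^ (-(J : ℤ))
  · have h3 := hf.mono _ _ _ _ (le_refl s) hc1
    rw [← smul_dyadic hs] at h3
    have h4 := mul_le_mul_of_nonneg_left h1 hs
    rw [dyadic] at h3
    linarith
  by_cases hc2 : s ≤ t * 2 ^ (-(J : ℤ))
  · have h3 := hf.mono _ _ _ _ hc2 (le_refl t)
    have h5 := eval_smul_point ht (2 ^ (-(J : ℤ))) 1 f
    rw [mul_one] at h5
    have h4 := mul_le_mul_of_nonneg_left h2 ht
    linarith
  rw [not_le] at hc1 hc2
  have hs0 : 0 < s := hc2.trans_le' (by positivity)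
  have ht0 : 0 < t := hc1.trans_le' (by positivity)
  -- For 2^i ≤ t/s < 2^(i+1) one has f(s, t) ≤ 2s ρ_i, while the bumps at i and i + 1 add up to at
  -- least s/2; this is the factor 4.
  obtain ⟨i, hi1, hi2⟩ := exists_mem_Ico_zpow (div_pos ht0 hs0) (one_lt_two (α := ℝ))
  rw [le_div_iff₀ hs0] at hi1
  rw [div_lt_iff₀ hs0] at hi2
  have hiJ : -(J : ℤ) < i + 1 := by
    rw [← zpow_lt_zpow_iff_right₀ (one_lt_two (α := ℝ))]
    refine lt_of_mul_lt_mul_right ?_ hs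
    linarith
  have hiJ' : i < J := by
    rw [← zpow_lt_zpow_iff_right₀ (one_lt_two (α := ℝ))]
    refine lt_of_mul_lt_mul_right ?_ hs
    rw [zpow_neg, ← div_eq_mul_inv, div_lt_iff₀ (by positivity)] at hc2
    linarith
  obtain ⟨n, hn⟩ := Int.eq_ofNat_of_zero_le (show 0 ≤ i + J by omega)
  have hin : i = -J + n := by omega
  have hsub : ({n, n + 1} : Finset ℕ) ⊆ Finset.range (2 * J + 1) := by
    intro m hm
    rw [Finset.mem_insert, Finset.mem_singleton] at hm
    rw [Finset.mem_range]
    omega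
  have h3 := Finset.sum_le_sum_of_subset_of_nonneg (f := fun n : ℕ =>
    f.dyadic (-J + n) * eval (s, t) (bump (-J + n))) hsub fun n _ _ => hnn _
  rw [Finset.sum_pair (by omega)] at h3
  have hin' : (-J + ((n + 1 : ℕ) : ℤ)) = i + 1 := by push_cast; omega
  rw [hin', ← hin] at h3
  have h4 := half_le_eval_bump_add hi1 hi2.le hs
  have h5 := hf.dyadic_mono (show i ≤ i + 1 by omega)
  have h6 : 0 ≤ eval (s, t) (bump (i + 1)) := by simpa using le_iff.1 (bump_nonneg (i + 1)) (s, t)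
  have h7 : f.dyadic i * (s / 2) ≤ f.dyadic i * eval (s, t) (bump i) +
      f.dyadic (i + 1) * eval (s, t) (bump (i + 1)) := by
    have := mul_le_mul_of_nonneg_left h4 (hf.dyadic_nonneg i)
    nlinarith
  have h8 : eval (s, t) f ≤ 2 * s * f.dyadic i := by
    rw [smul_dyadic (by positivity)]
    refine hf.mono _ _ _ _ (by linarith) (hi2.le.trans_eq ?_)
    rw [zpow_add₀ two_ne_zero, zpow_one]
    ring
  linarith

end Homog

/-! ### The continuous extension of φ. -/

section Extension

variable {φ : ℝ → ℝ → ℝ} {f g : Homog}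

open Filter in
-- Every value of f is a limit of values of φ in the open quadrant. Uniqueness of f, its positivity
-- and its monotonicity follow by passing to the limit.
theorem IsExtension.tendsto (hf : IsExtension φ f) (s t : ℝ) :
    Tendsto (fun n : ℕ => φ (max s 0 + 1 / ((n : ℝ) + 1)) (max t 0 + 1 / ((n : ℝ) + 1))) atTop
      (nhds (Homog.eval (s, t) f)) := by
  have h0 := tendsto_one_div_add_atTop_nhds_zero_nat (𝕜 := ℝ)
  have h1 : Tendsto (fun n : ℕ => (max s 0 + 1 / ((n : ℝ) + 1), max t 0 + 1 / ((n : ℝ) + 1)))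
      atTop (nhds (max s 0 + 0, max t 0 + 0)) :=
    (tendsto_const_nhds.add h0).prodMk_nhds (tendsto_const_nhds.add h0)
  rw [add_zero, add_zero] at h1
  have h2 := (f.1.continuous.tendsto _).comp h1
  rw [← hf.2 s t] at h2
  refine h2.congr fun n => ?_
  have hn : (0 : ℝ) < 1 / ((n : ℝ) + 1) := by positivity
  exact hf.1 _ _ (add_pos_of_nonneg_of_pos (le_max_right _ _) hn)
    (add_pos_of_nonneg_of_pos (le_max_right _ _) hn)

theorem IsExtension.unique (hf : IsExtension φ f) (hg : IsExtension φ g) : f = g :=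
  Subtype.ext (ContinuousMap.ext fun p => tendsto_nhds_unique (hf.tendsto p.1 p.2)
    (hg.tendsto p.1 p.2))

theorem IsExtension.isMono (hφ : ClassP φ) (hf : IsExtension φ f) : f.IsMono where
  nonneg p := by
    refine ge_of_tendsto' (hf.tendsto p.1 p.2) fun n => ?_
    have hn : (0 : ℝ) < 1 / ((n : ℝ) + 1) := by positivity
    exact hφ.nonneg _ _ (add_pos_of_nonneg_of_pos (le_max_right _ _) hn)
      (add_pos_of_nonneg_of_pos (le_max_right _ _) hn)
  mono s s' t t' hs ht := by
    refine le_of_tendsto_of_tendsto' (hf.tendsto s t) (hf.tendsto s' t') fun n => ?_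
    have hn : (0 : ℝ) < 1 / ((n : ℝ) + 1) := by positivity
    have hp : ∀ x : ℝ, 0 < max x 0 + 1 / ((n : ℝ) + 1) := fun x =>
      add_pos_of_nonneg_of_pos (le_max_right _ _) hn
    exact (hφ.mono_left _ _ _ (hp s) (add_le_add (max_le_max hs le_rfl) le_rfl) (hp t)).trans
      (hφ.mono_right _ _ _ (hp s') (hp t) (add_le_add (max_le_max ht le_rfl) le_rfl))
  eval_max s t := (hf.2 s t).symm

end Extension

/-! ### Families with common majorants and discretization of the calculus. -/

section Families

variable {L : Type*} [AddCommGroup L] [Lattice L] [IsOrderedAddMonoid L] [Module ℝ L]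
  [IsOrderedModule ℝ L]

/-- Divide by c; when c = 0 the bound forces every member to vanish. Coefficients f(1, 0), f(0, 1)
and ρ_e may indeed be zero. -/
theorem exists_eq_smul_of_sum_abs_le {ι : Type*} (s : Finset ι) (x : ι → L) {c : ℝ} (hc : 0 ≤ c)
    {W : L} (hW : 0 ≤ W) (h : ∑ i ∈ s, |x i| ≤ c • W) :
    ∃ z : ι → L, (∀ i ∈ s, x i = c • z i) ∧ ∑ i ∈ s, |z i| ≤ W := by
  rcases hc.eq_or_lt with rfl | hc
  · refine ⟨fun _ => 0, fun i hi => ?_, by simpa using hW⟩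
    rw [zero_smul] at h
    have h0 : |x i| ≤ 0 := (Finset.single_le_sum (fun j _ => abs_nonneg (x j)) hi).trans h
    rw [smul_zero]
    exact le_antisymm ((le_abs_self _).trans h0) (neg_nonpos.1 ((neg_le_abs _).trans h0))
  · refine ⟨fun i => c⁻¹ • x i, fun i _ => by rw [smul_smul, mul_inv_cancel₀ hc.ne', one_smul], ?_⟩
    simp only [abs_smul_of_lattice, abs_of_pos (inv_pos.2 hc)]
    rw [← Finset.smul_sum, inv_smul_le_iff_of_pos hc]
    exact h

theorem IsIdealEmbedding.exists_preimages {E κ : Type*} [AddCommGroup E] [Lattice E] [Module ℝ E]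
    [IsOrderedAddMonoid E] [Fintype κ] {ι : E →ₗ[ℝ] L} (hι : IsIdealEmbedding ι) {u : E}
    (hu : 0 ≤ u) (x : κ → L) (h : ∑ k, |x k| ≤ ι u) :
    ∃ a : κ → E, (∀ k, ι (a k) = x k) ∧ ∑ k, |a k| ≤ u := by
  have hex : ∀ k, ∃ a, ι a = x k := fun k => by
    obtain ⟨a, ha, -⟩ := hι.exists_of_abs_le (z := x k) hu
      ((Finset.single_le_sum (fun j _ => abs_nonneg (x j)) (Finset.mem_univ k)).trans h)
    exact ⟨a, ha⟩
  choose a ha using hex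
  refine ⟨a, ha, hι.le_iff.1 ?_⟩
  rw [map_sum]
  simpa only [hι.map_abs, ha] using h

/-- The supremum itself is the majorant. The index type is left arbitrary because regularity is
later used for families indexed by exponents and members at once. -/
theorem exists_majorant {X : Type u} {Y : Type v} {κ : Type*} [QuasiBanachLattice X]
    [QuasiBanachLattice Y] [Fintype κ] [Nonempty κ] {T : X →ₗ[ℝ] Y} {K : ℝ} (hK : 0 ≤ K)
    (hT : RegularBound T Set.univ qnorm Set.univ qnorm K) (a : κ → X) {x : X}
    (h : ∑ k, |a k| ≤ x) : ∃ y : Y, 0 ≤ y ∧ (∀ k, |T (a k)| ≤ y) ∧ qnorm y ≤ K * qnorm x := by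
  obtain ⟨m, hm⟩ := Nat.exists_eq_succ_of_ne_zero (Fintype.card_ne_zero (α := κ))
  let e : κ ≃ Fin (m + 1) := Fintype.equivFinOfCardEq hm
  have h1 := (hT.2 m (fun i => a (e.symm i)) fun _ => Set.mem_univ _).2
  have h2 : ∑ i, |a (e.symm i)| = ∑ k, |a k| := e.symm.sum_comp fun k => |a k|
  rw [h2] at h1
  have h3 : ∀ k, |T (a k)| ≤ Finset.univ.sup' Finset.univ_nonempty
      (fun i => |T (a (e.symm i))|) := fun k => by
    simpa using Finset.le_sup' (fun i => |T (a (e.symm i))|) (Finset.mem_univ (e k))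
  refine ⟨_, (abs_nonneg _).trans (h3 (Classical.arbitrary κ)), h3, h1.trans ?_⟩
  exact mul_le_mul_of_nonneg_left
    (qnorm_mono (Finset.sum_nonneg fun k _ => abs_nonneg _) h) hK

end Families

namespace IsKrivineCalculus

variable {L : Type*} [AddCommGroup L] [Lattice L] [IsOrderedAddMonoid L] [Module ℝ L]
  [IsOrderedModule ℝ L] {x₀ x₁ : L} {τ : Homog →ₗ[ℝ] L} (hτ : IsKrivineCalculus x₀ x₁ τ)
include hτ

theorem mono {f g : Homog} (h : f ≤ g) : τ f ≤ τ g := by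
  rw [← sup_eq_right, ← hτ.map_sup, sup_eq_right.2 h]

theorem map_fstPos (h : 0 ≤ x₀) : τ Homog.fstPos = x₀ := by
  rw [Homog.fstPos, hτ.map_sup, hτ.map_fst, map_zero, sup_eq_left.2 h]

theorem map_sndPos (h : 0 ≤ x₁) : τ Homog.sndPos = x₁ := by
  rw [Homog.sndPos, hτ.map_sup, hτ.map_snd, map_zero, sup_eq_left.2 h]

theorem smul {c : ℝ} (hc : 0 ≤ c) : IsKrivineCalculus (c • x₀) (c • x₁) (c • τ) where
  map_sup f g := by
    simp only [LinearMap.smul_apply]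
    rw [hτ.map_sup, smul_sup_of_nonneg hc]
  map_inf f g := by
    simp only [LinearMap.smul_apply]
    rw [hτ.map_inf, smul_inf_of_nonneg hc]
  map_fst := by rw [LinearMap.smul_apply, hτ.map_fst]
  map_snd := by rw [LinearMap.smul_apply, hτ.map_snd]

end IsKrivineCalculus

/-- The sets `E J` represent all the dyadic indices between `-J` and `J`, while `f` grows and
decays geometrically along them. -/
structure IsGrid (f : Homog) (E : ℕ → Finset ℤ) : Prop where
  sum_le : ∀ J, ∑ e ∈ E J, f.dyadic e • (Homog.fstPos ⊓ (2 ^ (-e) : ℝ) • Homog.sndPos) ≤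
    (5 : ℝ) • f
  represents : ∀ (J : ℕ) (j : ℤ), -J ≤ j → j ≤ J →
    ∃ e ∈ E J, Represents f.dyadic (fun j => f.dyadic j * 2 ^ (-j)) e j

theorem Homog.IsMono.exists_isGrid {f : Homog} (hf : f.IsMono) : ∃ E, IsGrid f E := by
  choose S hS hrep using fun J : ℕ => hf.exists_separated (-J) (2 * J)
  refine ⟨fun J => insert (-(J : ℤ) + ((2 * J : ℕ) : ℤ)) (S J),
    fun J => hf.sum_dyadic_smul_le _ (hS J), fun J j h1 h2 => hrep J j h1 ?_⟩
  push_cast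
  linarith

/-- Mass moved from j to e is multiplied by κ = 1 if e ≤ j and by κ = 2^(j-e) otherwise. Neither the
mass nor 2^(·) times the mass increases, and the value ρ_j is recovered up to a factor 4. -/
theorem Represents.exists_weight {f : Homog} {e j : ℤ}
    (h : Represents f.dyadic (fun j => f.dyadic j * 2 ^ (-j)) e j) :
    ∃ κ : ℝ, 0 ≤ κ ∧ κ ≤ 1 ∧ 2 ^ e * κ ≤ 2 ^ j ∧ f.dyadic j ≤ 4 * (f.dyadic e * κ) := by
  rcases h with ⟨h1, h2⟩ | ⟨h1, h2⟩
  · exact ⟨1, zero_le_one, le_rfl, by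
      rw [mul_one]; exact zpow_le_zpow_right₀ one_le_two h1, by rwa [mul_one]⟩
  · refine ⟨2 ^ (-e) * 2 ^ j, by positivity, ?_, ?_, ?_⟩
    · rw [← zpow_add₀ two_ne_zero]
      exact zpow_le_one_of_nonpos₀ one_le_two (by omega)
    · rw [← mul_assoc, ← zpow_add₀ two_ne_zero, add_neg_cancel, zpow_zero, one_mul]
    · have h3 : (2 : ℝ) ^ (-j) * 2 ^ j = 1 := by
        rw [← zpow_add₀ two_ne_zero, neg_add_cancel, zpow_zero]
      have h4 := mul_le_mul_of_nonneg_right h2 (show (0 : ℝ) ≤ 2 ^ j by positivity)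
      simp only [mul_assoc] at h4
      rwa [h3, mul_one] at h4

/-- Discretization of Krivine's functional calculus. -/
theorem IsKrivineCalculus.exists_discretization {L : Type*} [AddCommGroup L] [Lattice L]
    [IsOrderedAddMonoid L] [Module ℝ L] [IsOrderedModule ℝ L] {x₀ x₁ : L} {τ : Homog →ₗ[ℝ] L}
    (hτ : IsKrivineCalculus x₀ x₁ τ) (h0 : 0 ≤ x₀) (h1 : 0 ≤ x₁) {f : Homog} (hf : f.IsMono)
    {E : ℕ → Finset ℤ} (hE : IsGrid f E) {δ : ℝ} (hδ : 0 < δ) {J : ℕ}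
    (hJ : Homog.eval (1, 2 ^ (-(J : ℤ))) f ≤ Homog.eval (1, 0) f + δ ∧
      Homog.eval (2 ^ (-(J : ℤ)), 1) f ≤ Homog.eval (0, 1) f + δ) :
    ∃ Z : ℤ → L, (∀ e, 0 ≤ Z e) ∧ ∑ e ∈ E J, Z e ≤ (16 : ℝ) • x₀ ∧
      ∑ e ∈ E J, (2 ^ e : ℝ) • Z e ≤ (16 : ℝ) • x₁ ∧
      τ f ≤ ∑ e ∈ E J, f.dyadic e • Z e +
        ((Homog.eval (1, 0) f + δ) • x₀ + (Homog.eval (0, 1) f + δ) • x₁) := by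
  classical
  have hex : ∀ n : ℕ, ∃ e : ℤ, ∃ κ : ℝ, n ∈ Finset.range (2 * J + 1) → e ∈ E J ∧ 0 ≤ κ ∧ κ ≤ 1 ∧
      2 ^ e * κ ≤ 2 ^ (-(J : ℤ) + n) ∧ f.dyadic (-J + n) ≤ 4 * (f.dyadic e * κ) := by
    intro n
    by_cases hn : n ∈ Finset.range (2 * J + 1)
    · rw [Finset.mem_range] at hn
      obtain ⟨e, he, hrep⟩ := hE.represents J (-J + n) (by omega) (by omega)
      obtain ⟨κ, h⟩ := hrep.exists_weight
      exact ⟨e, κ, fun _ => ⟨he, h⟩⟩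
    · exact ⟨0, 0, fun h => absurd h hn⟩
  choose r κ hrκ using hex
  set B : ℕ → L := fun n => τ (Homog.bump (-J + n)) with hB
  have hB0 : ∀ n, 0 ≤ B n := fun n => by
    rw [← map_zero τ]
    exact hτ.mono (Homog.bump_nonneg _)
  have hmaps : ∀ n ∈ Finset.range (2 * J + 1), r n ∈ E J := fun n hn => (hrκ n hn).1
  have h16 : (0 : ℝ) ≤ 16 := by norm_num
  -- Z_e collects the weighted bumps of the exponents represented by e. The factor 16 combines the 4
  -- of the bump estimate with the 4 of the representation.
  refine ⟨fun e => (16 : ℝ) • ∑ n ∈ Finset.range (2 * J + 1) with r n = e, κ n • B n,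
    fun e => ?_, ?_, ?_, ?_⟩
  · exact smul_nonneg h16 (Finset.sum_nonneg fun n hn =>
      smul_nonneg (hrκ n (Finset.mem_filter.1 hn).1).2.1 (hB0 n))
  · rw [← Finset.smul_sum, Finset.sum_fiberwise_of_maps_to hmaps]
    refine smul_le_smul_of_nonneg_left ?_ h16
    calc ∑ n ∈ Finset.range (2 * J + 1), κ n • B n ≤ ∑ n ∈ Finset.range (2 * J + 1), B n := by
          refine Finset.sum_le_sum fun n hn => ?_
          have := smul_le_smul_of_nonneg_right (hrκ n hn).2.2.1 (hB0 n)
          rwa [one_smul] at this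
      _ = τ (∑ n ∈ Finset.range (2 * J + 1), Homog.bump (-J + n)) := by rw [map_sum]
      _ ≤ x₀ := by
        rw [← hτ.map_fstPos h0]
        exact hτ.mono (Homog.sum_bump_le _ _)
  · simp only [smul_comm _ (16 : ℝ)]
    rw [← Finset.smul_sum]
    refine smul_le_smul_of_nonneg_left ?_ h16
    calc ∑ e ∈ E J, (2 ^ e : ℝ) • ∑ n ∈ Finset.range (2 * J + 1) with r n = e, κ n • B n
        = ∑ e ∈ E J, ∑ n ∈ Finset.range (2 * J + 1) with r n = e, (2 ^ r n * κ n : ℝ) • B n := by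
          refine Finset.sum_congr rfl fun e _ => ?_
          rw [Finset.smul_sum]
          refine Finset.sum_congr rfl fun n hn => ?_
          rw [smul_smul, (Finset.mem_filter.1 hn).2]
      _ = ∑ n ∈ Finset.range (2 * J + 1), (2 ^ r n * κ n : ℝ) • B n :=
          Finset.sum_fiberwise_of_maps_to hmaps _
      _ ≤ ∑ n ∈ Finset.range (2 * J + 1), (2 ^ (-(J : ℤ) + n) : ℝ) • B n :=
          Finset.sum_le_sum fun n hn => smul_le_smul_of_nonneg_right (hrκ n hn).2.2.2.1 (hB0 n)
      _ = τ (∑ n ∈ Finset.range (2 * J + 1), (2 ^ (-(J : ℤ) + n) : ℝ) • Homog.bump (-J + n)) := by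
          rw [map_sum]
          simp only [map_smul, hB]
      _ ≤ x₁ := by
        rw [← hτ.map_sndPos h1]
        exact hτ.mono (Homog.sum_smul_bump_le _ _)
  · have h := hτ.mono (hf.le_sum_bump hδ hJ.1 hJ.2)
    rw [map_add, map_add, map_smul, map_smul, map_smul, hτ.map_fstPos h0, hτ.map_sndPos h1,
      map_sum] at h
    refine h.trans (add_le_add ?_ le_rfl)
    rw [Finset.smul_sum]
    calc ∑ n ∈ Finset.range (2 * J + 1),
          (4 : ℝ) • τ (f.dyadic (-J + n) • Homog.bump (-J + n))
        ≤ ∑ n ∈ Finset.range (2 * J + 1), (f.dyadic (r n) * (16 * κ n)) • B n := by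
          refine Finset.sum_le_sum fun n hn => ?_
          rw [map_smul, smul_smul]
          refine smul_le_smul_of_nonneg_right ?_ (hB0 n)
          linarith [(hrκ n hn).2.2.2.2]
      _ = ∑ e ∈ E J, ∑ n ∈ Finset.range (2 * J + 1) with r n = e,
            (f.dyadic (r n) * (16 * κ n)) • B n :=
          (Finset.sum_fiberwise_of_maps_to hmaps _).symm
      _ = _ := by
          refine Finset.sum_congr rfl fun e _ => ?_
          beta_reduce
          rw [Finset.smul_sum, Finset.smul_sum]
          refine Finset.sum_congr rfl fun n hn => ?_
          rw [smul_smul, smul_smul, (Finset.mem_filter.1 hn).2, mul_assoc]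

/-! ### Discretized and approximable elements of the sum space. -/

namespace CompatiblePair

variable {X₀ : Type u} {X₁ : Type v} [QuasiBanachLattice X₀] [QuasiBanachLattice X₁]
  (P : CompatiblePair.{w} X₀ X₁)

theorem sumNorm_nonneg (x : P.Sum) : 0 ≤ P.sumNorm x :=
  Real.sInf_nonneg (by
    rintro r ⟨a, b, -, rfl⟩
    exact add_nonneg (qnorm_nonneg _) (qnorm_nonneg _))

theorem exists_sumNorm_sum_le {ι : Type*} (s : Finset ι) : ∃ D : ℝ, 0 ≤ D ∧ ∀ g : ι → P.Sum,
    P.sumNorm (∑ i ∈ s, g i) ≤ D * ∑ i ∈ s, P.sumNorm (g i) := by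
  classical
  obtain ⟨C, hC, hadd⟩ := P.exists_sumNorm_add_le
  induction s using Finset.induction_on with
  | empty =>
    refine ⟨0, le_rfl, fun g => ?_⟩
    have := P.sumNorm_le (x := 0) (a := 0) (b := 0) (by simp)
    simpa [qnorm_zero] using this
  | insert i s hi ih =>
    obtain ⟨D, hD, h⟩ := ih
    refine ⟨C * (1 + D), by positivity, fun g => ?_⟩
    rw [Finset.sum_insert hi, Finset.sum_insert hi]
    refine (hadd _ _).trans ?_
    rw [mul_assoc]
    refine mul_le_mul_of_nonneg_left ?_ (by linarith)
    have h1 := h g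
    have h2 := P.sumNorm_nonneg (g i)
    have h3 : 0 ≤ ∑ j ∈ s, P.sumNorm (g j) := Finset.sum_nonneg fun j _ => P.sumNorm_nonneg _
    nlinarith

/-- `v` is dominated by a discrete combination along `E` whose coefficients are controlled in
`X₀` and in `X₁`. -/
def IsDiscretized (f : Homog) (E : Finset ℤ) (c : ℝ) (v : P.Sum) : Prop :=
  0 ≤ v ∧ ∃ (Z : ℤ → P.Sum) (u₀ : X₀) (u₁ : X₁), (∀ e, 0 ≤ Z e) ∧ 0 ≤ u₀ ∧ 0 ≤ u₁ ∧
    qnorm u₀ ≤ c ∧ qnorm u₁ ≤ c ∧ ∑ e ∈ E, Z e ≤ P.ι₀ u₀ ∧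
    ∑ e ∈ E, (2 ^ e : ℝ) • Z e ≤ P.ι₁ u₁ ∧
    v ≤ ∑ e ∈ E, f.dyadic e • Z e +
      (Homog.eval (1, 0) f • P.ι₀ u₀ + Homog.eval (0, 1) f • P.ι₁ u₁)

/-- `|w|` is approximable by discretized elements. -/
def IsApproximable (f : Homog) (E : ℕ → Finset ℤ) (c : ℝ) (w : P.Sum) : Prop :=
  ∀ ε : ℝ, 0 < ε → ∃ J₀ : ℕ, ∀ J, J₀ ≤ J → ∃ v, P.IsDiscretized f (E J) c v ∧
    P.sumNorm ((|w| - v) ⊔ 0) < ε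

variable {P} {φ : ℝ → ℝ → ℝ} {f : Homog} {E : ℕ → Finset ℤ}

theorem IsDiscretized.mono {S : Finset ℤ} {c c' : ℝ} {v : P.Sum} (h : P.IsDiscretized f S c v)
    (hc : c ≤ c') : P.IsDiscretized f S c' v := by
  obtain ⟨hv, Z, u₀, u₁, hZ, h0, h1, hq0, hq1, h⟩ := h
  exact ⟨hv, Z, u₀, u₁, hZ, h0, h1, hq0.trans hc, hq1.trans hc, h⟩

theorem IsDiscretized.smul {S : Finset ℤ} {c r : ℝ} {v : P.Sum} (h : P.IsDiscretized f S c v)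
    (hr : 0 ≤ r) : P.IsDiscretized f S (r * c) (r • v) := by
  obtain ⟨hv, Z, u₀, u₁, hZ, h0, h1, hq0, hq1, hs0, hs1, h⟩ := h
  refine ⟨smul_nonneg hr hv, fun e => r • Z e, r • u₀, r • u₁, fun e => smul_nonneg hr (hZ e),
    smul_nonneg hr h0, smul_nonneg hr h1, ?_, ?_, ?_, ?_, ?_⟩
  · rw [qnorm_smul_of_nonneg hr]
    exact mul_le_mul_of_nonneg_left hq0 hr
  · rw [qnorm_smul_of_nonneg hr]
    exact mul_le_mul_of_nonneg_left hq1 hr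
  · rw [← Finset.smul_sum, map_smul]
    exact smul_le_smul_of_nonneg_left hs0 hr
  · simp only [smul_comm _ r]
    rw [← Finset.smul_sum, map_smul]
    exact smul_le_smul_of_nonneg_left hs1 hr
  · simp only [map_smul, smul_comm _ r]
    rw [← Finset.smul_sum, ← smul_add, ← smul_add]
    exact smul_le_smul_of_nonneg_left h hr

theorem IsApproximable.mono {c c' : ℝ} {w : P.Sum} (h : P.IsApproximable f E c w) (hc : c ≤ c') :
    P.IsApproximable f E c' w := fun ε hε => by
  obtain ⟨J₀, hJ⟩ := h ε hε
  refine ⟨J₀, fun J hJJ => ?_⟩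
  obtain ⟨v, hv, hlt⟩ := hJ J hJJ
  exact ⟨v, hv.mono hc, hlt⟩

theorem IsApproximable.smul {c r : ℝ} {w : P.Sum} (h : P.IsApproximable f E c w) (hr : 0 < r) :
    P.IsApproximable f E (r * c) (r • w) := fun ε hε => by
  obtain ⟨J₀, hJ⟩ := h (ε / r) (div_pos hε hr)
  refine ⟨J₀, fun J hJJ => ?_⟩
  obtain ⟨v, hv, hlt⟩ := hJ J hJJ
  refine ⟨r • v, hv.smul hr.le, ?_⟩
  have e : (|r • w| - r • v) ⊔ 0 = r • ((|w| - v) ⊔ 0) := by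
    rw [abs_smul_of_lattice, abs_of_pos hr, smul_sup_of_nonneg hr.le, smul_sub, smul_zero]
  rw [e]
  refine (P.sumNorm_smul_le _ _).trans_lt ?_
  rwa [abs_of_pos hr, mul_comm, ← lt_div_iff₀ hr]

theorem IsApproximable.abs {c : ℝ} {w : P.Sum} (h : P.IsApproximable f E c w) :
    P.IsApproximable f E c |w| := by
  simpa only [IsApproximable, abs_abs] using h

theorem isApproximable_zero : P.IsApproximable f E 0 0 := fun ε hε => by
  refine ⟨0, fun J _ => ⟨0, ⟨le_rfl, fun _ => 0, 0, 0, by simp [qnorm_zero]⟩, ?_⟩⟩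
  have := P.sumNorm_le (x := 0) (a := 0) (b := 0) (by simp)
  rw [qnorm_zero, qnorm_zero, add_zero] at this
  simpa using this.trans_lt hε

/-- The sets E J depend only on f and J, so two discretizations at the same level J can be added
exponent by exponent. The constant may grow uncontrolled, as the lemma only serves to establish
membership. -/
theorem IsApproximable.add {c c' : ℝ} {w w' : P.Sum} (h : P.IsApproximable f E c w)
    (h' : P.IsApproximable f E c' w') : ∃ c'', P.IsApproximable f E c'' (w + w') := by
  obtain ⟨D₀, hD₀, hadd0⟩ := exists_qnorm_add_le (E := X₀)
  obtain ⟨D₁, hD₁, hadd1⟩ := exists_qnorm_add_le (E := X₁)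
  obtain ⟨C, hC, hadd⟩ := P.exists_sumNorm_add_le
  refine ⟨max (D₀ * (c + c')) (D₁ * (c + c')), fun ε hε => ?_⟩
  have hC0 : 0 < C := by linarith
  obtain ⟨J₀, hJ⟩ := h (ε / (2 * C)) (by positivity)
  obtain ⟨J₁, hJ'⟩ := h' (ε / (2 * C)) (by positivity)
  refine ⟨max J₀ J₁, fun J hJJ => ?_⟩
  obtain ⟨v, ⟨hv, Z, u₀, u₁, hZ, h0, h1, hq0, hq1, hs0, hs1, hvZ⟩, hlt⟩ :=
    hJ J ((le_max_left _ _).trans hJJ)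
  obtain ⟨v', ⟨hv', Z', u₀', u₁', hZ', h0', h1', hq0', hq1', hs0', hs1', hvZ'⟩, hlt'⟩ :=
    hJ' J ((le_max_right _ _).trans hJJ)
  refine ⟨v + v', ⟨add_nonneg hv hv', fun e => Z e + Z' e, u₀ + u₀', u₁ + u₁',
    fun e => add_nonneg (hZ e) (hZ' e), add_nonneg h0 h0', add_nonneg h1 h1', ?_, ?_, ?_, ?_, ?_⟩,
    ?_⟩
  · exact ((hadd0 _ _).trans (mul_le_mul_of_nonneg_left (add_le_add hq0 hq0')
      (by linarith))).trans (le_max_left _ _)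
  · exact ((hadd1 _ _).trans (mul_le_mul_of_nonneg_left (add_le_add hq1 hq1')
      (by linarith))).trans (le_max_right _ _)
  · rw [Finset.sum_add_distrib, map_add]
    exact add_le_add hs0 hs0'
  · simp only [smul_add]
    rw [Finset.sum_add_distrib, map_add]
    exact add_le_add hs1 hs1'
  · simp only [smul_add, map_add]
    rw [Finset.sum_add_distrib]
    exact (add_le_add hvZ hvZ').trans_eq (by abel)
  · have e : (|w + w'| - (v + v')) ⊔ 0 ≤ (|w| - v) ⊔ 0 + (|w'| - v') ⊔ 0 := by
      refine (sup_le_sup_right ?_ 0).trans (sup_zero_add_le _ _)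
      rw [sub_add_sub_comm]
      exact sub_le_sub_right (abs_add_le _ _) _
    refine (P.sumNorm_mono ?_).trans_lt ((hadd ((|w| - v) ⊔ 0) ((|w'| - v') ⊔ 0)).trans_lt ?_)
    · rw [abs_of_nonneg le_sup_right, abs_of_nonneg (le_sup_right.trans e)]
      exact e
    · rw [lt_div_iff₀ (by positivity)] at hlt hlt'
      nlinarith

theorem IsApproximable.sum {ι : Type*} (s : Finset ι) {w : ι → P.Sum}
    (h : ∀ i ∈ s, ∃ c, P.IsApproximable f E c (w i)) :
    ∃ c, P.IsApproximable f E c (∑ i ∈ s, w i) := by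
  classical
  induction s using Finset.induction_on with
  | empty => exact ⟨0, by rw [Finset.sum_empty]; exact isApproximable_zero⟩
  | insert i s hi ih =>
    obtain ⟨c, hc⟩ := ih fun j hj => h j (Finset.mem_insert_of_mem hj)
    obtain ⟨c', hc'⟩ := h i (Finset.mem_insert_self _ _)
    rw [Finset.sum_insert hi]
    exact hc'.add hc

theorem clNorm_set_nonempty {a : P.Sum} (ha : a ∈ P.clSpace φ) :
    {r : ℝ | 0 < r ∧ ∃ (x₀ : X₀) (x₁ : X₁) (y : P.Sum), 0 ≤ x₀ ∧ 0 ≤ x₁ ∧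
      QuasiBanachLattice.qnorm x₀ ≤ 1 ∧ QuasiBanachLattice.qnorm x₁ ≤ 1 ∧
      IsValue φ (P.ι₀ x₀) (P.ι₁ x₁) y ∧ |a| ≤ r • y}.Nonempty := by
  obtain ⟨x₀, x₁, y, h0, h1, ⟨τ, f, hτ, hf, rfl⟩, hay⟩ := ha
  have hq0 := qnorm_nonneg x₀
  have hq1 := qnorm_nonneg x₁
  set c := qnorm x₀ + qnorm x₁ + 1 with hc
  have hc0 : 0 < c := by positivity
  have hci : 0 ≤ c⁻¹ := by positivity
  refine ⟨c, hc0, c⁻¹ • x₀, c⁻¹ • x₁, c⁻¹ • τ f, smul_nonneg hci h0, smul_nonneg hci h1,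
    ?_, ?_, ⟨c⁻¹ • τ, f, ?_, hf, rfl⟩, ?_⟩
  · rw [qnorm_smul_of_nonneg hci, inv_mul_le_iff₀ hc0]
    linarith
  · rw [qnorm_smul_of_nonneg hci, inv_mul_le_iff₀ hc0]
    linarith
  · rw [map_smul, map_smul]
    exact hτ.smul hci
  · rwa [smul_smul, mul_inv_cancel₀ hc0.ne', one_smul]

theorem clNorm_mono {a b : P.Sum} (ha : a ∈ P.clSpace φ) (h : |b| ≤ |a|) :
    P.clNorm φ b ≤ P.clNorm φ a :=
  csInf_le_csInf ⟨0, fun _ hr => hr.1.le⟩ (clNorm_set_nonempty ha)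
    fun _ ⟨hr, x₀, x₁, y, h0, h1, hq0, hq1, hy, hay⟩ =>
      ⟨hr, x₀, x₁, y, h0, h1, hq0, hq1, hy, h.trans hay⟩

/-- Membership in the unit ball is witnessed by a dominating value of the functional calculus. -/
theorem exists_le_of_clNorm_le_one {a : P.Sum} (ha : a ∈ P.clSpace φ) (hN : P.clNorm φ a ≤ 1) :
    ∃ (x₀ : X₀) (x₁ : X₁) (y : P.Sum), 0 ≤ x₀ ∧ 0 ≤ x₁ ∧ qnorm x₀ ≤ 1 ∧ qnorm x₁ ≤ 1 ∧
      IsValue φ (P.ι₀ x₀) (P.ι₁ x₁) y ∧ 0 ≤ y ∧ |a| ≤ (2 : ℝ) • y := by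
  obtain ⟨r, ⟨hr, x₀, x₁, y, h0, h1, hq0, hq1, hy, hay⟩, hr2⟩ :=
    exists_lt_of_csInf_lt (clNorm_set_nonempty ha) (hN.trans_lt one_lt_two)
  have hy0 : 0 ≤ y := by
    have h2 := smul_nonneg (inv_pos.2 hr).le ((abs_nonneg a).trans hay)
    rwa [smul_smul, inv_mul_cancel₀ hr.ne', one_smul] at h2
  exact ⟨x₀, x₁, y, h0, h1, hq0, hq1, hy, hy0,
    hay.trans (smul_le_smul_of_nonneg_right hr2.le hy0)⟩

/-- Replace b by a nearby a with |a| ≤ 2 f(x₀, x₁) and discretize that value; 32 is this 2 times the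
16 of the discretization. -/
theorem isApproximable_of_mem_phiCBall (hφ : ClassP φ) (hf : IsExtension φ f) (hE : IsGrid f E)
    {b : P.Sum} (hb : b ∈ P.phiCBall φ) : P.IsApproximable f E 32 b := by
  intro ε hε
  have hfm := hf.isMono hφ
  obtain ⟨C, hC, hadd⟩ := P.exists_sumNorm_add_le
  have hC0 : 0 < C := by linarith
  obtain ⟨a, ha, haN, hlt⟩ := hb (ε / (2 * C)) (by positivity)
  obtain ⟨x₀, x₁, y, h0, h1, hq0, hq1, ⟨τ, g, hτ, hg, rfl⟩, hy0, hay⟩ :=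
    exists_le_of_clNorm_le_one ha haN
  obtain rfl := hf.unique hg
  -- The boundary error 2δ(x₀ + x₁) has quasi-norm at most 4δ, which contributes ε/4 after
  -- multiplication by C; the distance from b to a contributes less than ε/2.
  set δ := ε / (16 * C) with hδ
  have hδ0 : 0 < δ := by positivity
  obtain ⟨J₀, hJ⟩ := f.exists_grid hδ0
  refine ⟨J₀, fun J hJJ => ?_⟩
  have hi0 := P.isIdealEmbedding₀.map_nonneg h0
  have hi1 := P.isIdealEmbedding₁.map_nonneg h1
  obtain ⟨Z, hZ, hs0, hs1, hle⟩ := hτ.exists_discretization hi0 hi1 hfm hE hδ0 (hJ J hJJ)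
  have h2 : (0 : ℝ) ≤ 2 := by norm_num
  have h32 : (0 : ℝ) ≤ 32 := by norm_num
  have hα := hfm.nonneg (1, 0)
  have hβ := hfm.nonneg (0, 1)
  set α := Homog.eval (1, 0) f with hαd
  set β := Homog.eval (0, 1) f with hβd
  set v : P.Sum := (2 : ℝ) • (∑ e ∈ E J, f.dyadic e • Z e + (α • P.ι₀ x₀ + β • P.ι₁ x₁)) with hv
  have hv0 : 0 ≤ v := smul_nonneg h2 (add_nonneg
    (Finset.sum_nonneg fun e _ => smul_nonneg (hfm.dyadic_nonneg e) (hZ e))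
    (add_nonneg (smul_nonneg hα hi0) (smul_nonneg hβ hi1)))
  refine ⟨v, ⟨hv0, fun e => (2 : ℝ) • Z e, (32 : ℝ) • x₀, (32 : ℝ) • x₁,
    fun e => smul_nonneg h2 (hZ e), smul_nonneg h32 h0, smul_nonneg h32 h1, ?_, ?_, ?_, ?_, ?_⟩, ?_⟩
  · rw [qnorm_smul_of_nonneg h32]; linarith
  · rw [qnorm_smul_of_nonneg h32]; linarith
  · rw [← Finset.smul_sum, map_smul]
    refine (smul_le_smul_of_nonneg_left hs0 h2).trans_eq ?_
    rw [smul_smul]; norm_num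
  · simp only [smul_comm _ (2 : ℝ)]
    rw [← Finset.smul_sum, map_smul]
    refine (smul_le_smul_of_nonneg_left hs1 h2).trans_eq ?_
    rw [smul_smul]; norm_num
  · simp only [smul_comm _ (2 : ℝ)]
    rw [← Finset.smul_sum, hv, map_smul, map_smul, smul_comm α, smul_comm β,
      ← smul_add (32 : ℝ)]
    refine (smul_add (2 : ℝ) _ _).trans_le (add_le_add le_rfl ?_)
    refine smul_le_smul_of_nonneg_right (by norm_num : (2 : ℝ) ≤ 32) ?_
    exact add_nonneg (smul_nonneg hα hi0) (smul_nonneg hβ hi1)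
  · have h3 : |b| - v ≤ |b - a| + (P.ι₀ ((2 * δ) • x₀) + P.ι₁ ((2 * δ) • x₁)) := by
      rw [sub_le_iff_le_add]
      calc |b| = |(b - a) + a| := by rw [sub_add_cancel]
        _ ≤ |b - a| + (2 : ℝ) • τ f := (abs_add_le _ _).trans (add_le_add le_rfl hay)
        _ ≤ |b - a| + (2 : ℝ) • (∑ e ∈ E J, f.dyadic e • Z e +
            ((α + δ) • P.ι₀ x₀ + (β + δ) • P.ι₁ x₁)) :=
          add_le_add le_rfl (smul_le_smul_of_nonneg_left hle h2)
        _ = _ := by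
          rw [hv, map_smul, map_smul]
          module
    have h4 : 0 ≤ P.ι₀ ((2 * δ) • x₀) + P.ι₁ ((2 * δ) • x₁) :=
      add_nonneg (P.isIdealEmbedding₀.map_nonneg (smul_nonneg (by positivity) h0))
        (P.isIdealEmbedding₁.map_nonneg (smul_nonneg (by positivity) h1))
    have h5 : P.sumNorm ((|b| - v) ⊔ 0) ≤
        P.sumNorm (|b - a| + (P.ι₀ ((2 * δ) • x₀) + P.ι₁ ((2 * δ) • x₁))) := by
      refine P.sumNorm_mono ?_
      rw [abs_of_nonneg le_sup_right, abs_of_nonneg (add_nonneg (abs_nonneg _) h4)]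
      exact sup_le h3 (add_nonneg (abs_nonneg _) h4)
    have h6 := hadd |b - a| (P.ι₀ ((2 * δ) • x₀) + P.ι₁ ((2 * δ) • x₁))
    have h7 : P.sumNorm |b - a| ≤ P.sumNorm (b - a) := P.sumNorm_mono (by rw [abs_abs])
    have h8 := P.sumNorm_le (x := P.ι₀ ((2 * δ) • x₀) + P.ι₁ ((2 * δ) • x₁)) rfl
    rw [qnorm_smul_of_nonneg (by positivity), qnorm_smul_of_nonneg (by positivity)] at h8
    have h9 : 2 * δ * qnorm x₀ + 2 * δ * qnorm x₁ ≤ 4 * δ := by nlinarith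
    have h10 : C * δ = ε / 16 := by rw [hδ]; field_simp
    rw [lt_div_iff₀ (by positivity)] at hlt
    nlinarith

/-- Solidity survives the closure: clip b' at |a| for each approximant a of b. The clipped element
stays in the ball, and the remainder is at most (|b'| - |a|)⁺ ≤ |b - a|. -/
theorem mem_phiCBall_of_abs_le {b b' : P.Sum} (hb : b ∈ P.phiCBall φ) (h : |b'| ≤ |b|) :
    b' ∈ P.phiCBall φ := by
  intro ε hε
  obtain ⟨a, ha, haN, hlt⟩ := hb ε hε
  obtain ⟨p, hp, hbp⟩ := exists_clip (Finset.univ : Finset Unit) (fun _ => b') |a| (abs_nonneg a)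
  simp only [Finset.univ_unique, Finset.sum_singleton] at hp hbp
  refine ⟨p default, ?_, ?_, (P.sumNorm_mono (hbp.trans ?_)).trans_lt hlt⟩
  · obtain ⟨x₀, x₁, y, h0, h1, hy, hay⟩ := ha
    exact ⟨x₀, x₁, y, h0, h1, hy, hp.trans hay⟩
  · exact (clNorm_mono ha hp).trans haN
  · refine sup_le ?_ (abs_nonneg _)
    refine (sub_le_sub_right h _).trans ?_
    rw [sub_le_iff_le_add]
    exact (abs_add_le (b - a) a).trans' (by rw [sub_add_cancel])

end CompatiblePair

/-! ### Action of regular operators on discretized elements. -/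

section Transfer

theorem RegularBound.mono {E F : Type*} [AddCommGroup E] [Lattice E] [Module ℝ E] [AddCommGroup F]
    [Lattice F] [Module ℝ F] {T : E →ₗ[ℝ] F} {D : Set E} {N : E → ℝ} {D' : Set F} {N' : F → ℝ}
    {K K' : ℝ} (h : RegularBound T D N D' N' K) (hN : ∀ x, 0 ≤ N x) (hK : K ≤ K') :
    RegularBound T D N D' N' K' :=
  ⟨h.1, fun n x hx => ⟨(h.2 n x hx).1,
    (h.2 n x hx).2.trans (mul_le_mul_of_nonneg_right hK (hN _))⟩⟩

theorem regularBound_id (X : Type u) [QuasiBanachLattice X] :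
    RegularBound (LinearMap.id : X →ₗ[ℝ] X) Set.univ qnorm Set.univ qnorm 1 := by
  refine ⟨fun _ _ => Set.mem_univ _, fun n x _ => ⟨Set.mem_univ _, ?_⟩⟩
  rw [one_mul]
  refine qnorm_mono ?_ (Finset.sup'_le _ _ fun i hi => ?_)
  · exact (abs_nonneg _).trans (Finset.le_sup' (fun i => |LinearMap.id (R := ℝ) (x i)|)
      (Finset.mem_univ 0))
  · exact Finset.single_le_sum (fun j _ => abs_nonneg (x j)) hi

variable {X : Type u} {Y : Type v} [QuasiBanachLattice X] [QuasiBanachLattice Y]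
  {L L' : Type*} [AddCommGroup L] [Lattice L] [IsOrderedAddMonoid L] [Module ℝ L]
  [IsOrderedModule ℝ L] [AddCommGroup L'] [Lattice L'] [IsOrderedAddMonoid L'] [Module ℝ L']
  [IsOrderedModule ℝ L']

/-- A regular operator between ideals of `L` and `L'` maps a family in `L` to a family with a
common majorant. -/
theorem exists_common_majorant {ι : X →ₗ[ℝ] L} {ι' : Y →ₗ[ℝ] L'} (hι : IsIdealEmbedding ι)
    (hι' : IsIdealEmbedding ι') {T : L →ₗ[ℝ] L'} {T₀ : X →ₗ[ℝ] Y}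
    (hT : ∀ x, T (ι x) = ι' (T₀ x)) {K : ℝ} (hK : 0 ≤ K)
    (hreg : RegularBound T₀ Set.univ qnorm Set.univ qnorm K) {κ : Type*} [Fintype κ] [Nonempty κ]
    (w : κ → L) {x : X} (hx : 0 ≤ x) (h : ∑ k, |w k| ≤ ι x) :
    ∃ y : Y, 0 ≤ y ∧ (∀ k, |T (w k)| ≤ ι' y) ∧ qnorm y ≤ K * qnorm x := by
  obtain ⟨a, ha, hax⟩ := hι.exists_preimages hx w h
  obtain ⟨y, hy, hyT, hyq⟩ := exists_majorant hK hreg a hax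
  refine ⟨y, hy, fun k => ?_, hyq⟩
  rw [← ha k, hT, ← hι'.map_abs]
  exact hι'.le_iff.2 (hyT k)

end Transfer

namespace CompatiblePair

variable {X₀ : Type u} {X₁ : Type v} [QuasiBanachLattice X₀] [QuasiBanachLattice X₁]
  {Y₀ : Type u'} {Y₁ : Type v'} [QuasiBanachLattice Y₀] [QuasiBanachLattice Y₁]
  {P : CompatiblePair.{w} X₀ X₁} {Q : CompatiblePair.{w'} Y₀ Y₁} {φ : ℝ → ℝ → ℝ} {f : Homog}
  {E : ℕ → Finset ℤ} {T : P.Sum →ₗ[ℝ] Q.Sum} {T₀ : X₀ →ₗ[ℝ] Y₀} {T₁ : X₁ →ₗ[ℝ] Y₁} {K : ℝ}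

/-- This is where regularity meets sparsity. One majorant in each space serves all exponents and all
members, so |T z_{e,i}| lies below both y₀ and 2^(-e) y₁, and summing over the sparse exponents
costs only a constant. -/
theorem IsDiscretized.exists_majorant (hf : f.IsMono) (hE : IsGrid f E) (hK : 0 ≤ K)
    (hT₀ : ∀ x, T (P.ι₀ x) = Q.ι₀ (T₀ x)) (hT₁ : ∀ x, T (P.ι₁ x) = Q.ι₁ (T₁ x))
    (hr₀ : RegularBound T₀ Set.univ qnorm Set.univ qnorm K)
    (hr₁ : RegularBound T₁ Set.univ qnorm Set.univ qnorm K) {J : ℕ} {c : ℝ} {v : P.Sum}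
    (hv : P.IsDiscretized f (E J) c v) {n : ℕ} (x : Fin (n + 1) → P.Sum) (hx : ∑ i, |x i| ≤ v) :
    ∃ (y₀ : Y₀) (y₁ : Y₁) (τ : Homog →ₗ[ℝ] Q.Sum), 0 ≤ y₀ ∧ 0 ≤ y₁ ∧ qnorm y₀ ≤ 2 * c * K ∧
      qnorm y₁ ≤ 2 * c * K ∧ IsKrivineCalculus (Q.ι₀ y₀) (Q.ι₁ y₁) τ ∧
      ∀ i, |T (x i)| ≤ (7 : ℝ) • τ f := by
  obtain ⟨-, Z, u₀, u₁, hZ, hu0, hu1, hq0, hq1, hs0, hs1, hvZ⟩ := hv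
  have hα := hf.nonneg (1, 0)
  have hβ := hf.nonneg (0, 1)
  have hi0 := P.isIdealEmbedding₀.map_nonneg hu0
  have hi1 := P.isIdealEmbedding₁.map_nonneg hu1
  obtain ⟨p, q, hpq, hp, hq⟩ := exists_riesz_two Finset.univ x _ _
    (Finset.sum_nonneg fun e _ => smul_nonneg (hf.dyadic_nonneg e) (hZ e))
    (add_nonneg (smul_nonneg hα hi0) (smul_nonneg hβ hi1)) (hx.trans hvZ)
  obtain ⟨g, h, hgh, hg, hh⟩ := exists_riesz_two Finset.univ q _ _
    (smul_nonneg hα hi0) (smul_nonneg hβ hi1) hq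
  obtain ⟨W, hW, hWZ⟩ := exists_riesz Finset.univ (E J) p _
    (fun e => smul_nonneg (hf.dyadic_nonneg e) (hZ e)) hp
  obtain ⟨g', hg', hgs⟩ := exists_eq_smul_of_sum_abs_le _ g hα hi0 hg
  obtain ⟨h', hh', hhs⟩ := exists_eq_smul_of_sum_abs_le _ h hβ hi1 hh
  choose z hz hzs using fun e : E J =>
    exists_eq_smul_of_sum_abs_le _ (W e) (hf.dyadic_nonneg e) (hZ e) (hWZ e e.2)
  -- The dyadic pieces and the boundary pieces are each dominated by u₀ and enter one family, hence
  -- the factor 2 in the bounds for y₀ and, likewise, y₁.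
  have hsum0 : ∑ k : (E J × Fin (n + 1)) ⊕ Fin (n + 1),
      |Sum.elim (fun k : E J × Fin (n + 1) => z k.1 k.2) g' k| ≤ P.ι₀ ((2 : ℝ) • u₀) := by
    rw [Fintype.sum_sum_type, Fintype.sum_prod_type, map_smul, two_smul]
    refine add_le_add ?_ hgs
    refine (Finset.sum_le_sum fun e _ => hzs e).trans ?_
    rw [Finset.sum_coe_sort (E J) Z]
    exact hs0
  have hsum1 : ∑ k : (E J × Fin (n + 1)) ⊕ Fin (n + 1),
      |Sum.elim (fun k : E J × Fin (n + 1) => (2 ^ (k.1 : ℤ) : ℝ) • z k.1 k.2) h' k| ≤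
        P.ι₁ ((2 : ℝ) • u₁) := by
    rw [Fintype.sum_sum_type, Fintype.sum_prod_type, map_smul, two_smul]
    refine add_le_add ?_ hhs
    refine le_trans (Finset.sum_le_sum fun e _ =>
      (?_ : _ ≤ (2 ^ (e : ℤ) : ℝ) • Z e)) ?_
    · have h2 : (0 : ℝ) ≤ 2 ^ (e : ℤ) := by positivity
      simp only [Sum.elim_inl, abs_smul_of_lattice, abs_of_nonneg h2]
      rw [← Finset.smul_sum]
      exact smul_le_smul_of_nonneg_left (hzs e) h2
    · rw [Finset.sum_coe_sort (E J) fun e => (2 ^ e : ℝ) • Z e]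
      exact hs1
  have h2 : (0 : ℝ) ≤ 2 := by norm_num
  obtain ⟨y₀, hy0, hyT0, hyq0⟩ := exists_common_majorant P.isIdealEmbedding₀ Q.isIdealEmbedding₀
    hT₀ hK hr₀ _ (smul_nonneg h2 hu0) hsum0
  obtain ⟨y₁, hy1, hyT1, hyq1⟩ := exists_common_majorant P.isIdealEmbedding₁ Q.isIdealEmbedding₁
    hT₁ hK hr₁ _ (smul_nonneg h2 hu1) hsum1
  rw [qnorm_smul_of_nonneg h2] at hyq0 hyq1
  obtain ⟨τ, hτ⟩ := Q.exists_isKrivineCalculus hy0 hy1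
  have hj0 := Q.isIdealEmbedding₀.map_nonneg hy0
  have hj1 := Q.isIdealEmbedding₁.map_nonneg hy1
  refine ⟨y₀, y₁, τ, hy0, hy1, by nlinarith, by nlinarith, hτ, fun i => ?_⟩
  have hTz : ∀ e : E J, |T (z e i)| ≤ Q.ι₀ y₀ ⊓ (2 ^ (-(e : ℤ)) : ℝ) • Q.ι₁ y₁ := by
    intro e
    refine le_inf (hyT0 (Sum.inl (e, i))) ?_
    have h3 := hyT1 (Sum.inl (e, i))
    simp only [Sum.elim_inl, map_smul] at h3
    rw [abs_smul_of_lattice, abs_of_pos (by positivity)] at h3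
    rw [zpow_neg, le_inv_smul_iff_of_pos (by positivity)]
    exact h3
  have hxi : x i = ∑ e : E J, f.dyadic e • z e i +
      (Homog.eval (1, 0) f • g' i + Homog.eval (0, 1) f • h' i) := by
    rw [hpq i, hgh i, hW i (Finset.mem_univ i), hg' i (Finset.mem_univ i),
      hh' i (Finset.mem_univ i), ← Finset.sum_coe_sort (E J) fun e => W e i]
    simp only [hz _ i (Finset.mem_univ i)]
  have h5 : τ (∑ e ∈ E J, f.dyadic e • (Homog.fstPos ⊓ (2 ^ (-e) : ℝ) • Homog.sndPos)) =
      ∑ e : E J, f.dyadic e • (Q.ι₀ y₀ ⊓ (2 ^ (-(e : ℤ)) : ℝ) • Q.ι₁ y₁) := by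
    rw [map_sum, ← Finset.sum_coe_sort]
    simp only [map_smul, hτ.map_inf, hτ.map_fstPos hj0, hτ.map_sndPos hj1]
  have h6 := hτ.mono (hE.sum_le J)
  rw [h5, map_smul] at h6
  have h7 := hτ.mono hf.smul_fstPos_le
  rw [map_smul, hτ.map_fstPos hj0] at h7
  have h8 := hτ.mono hf.smul_sndPos_le
  rw [map_smul, hτ.map_sndPos hj1] at h8
  rw [hxi, map_add, map_add, map_sum, map_smul, map_smul]
  calc _ ≤ ∑ e : E J, |T (f.dyadic e • z e i)| + (|Homog.eval (1, 0) f • T (g' i)| +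
        |Homog.eval (0, 1) f • T (h' i)|) :=
      (abs_add_le _ _).trans (add_le_add (abs_sum_le_sum_abs_of_lattice _ _) (abs_add_le _ _))
    _ ≤ ∑ e : E J, f.dyadic e • (Q.ι₀ y₀ ⊓ (2 ^ (-(e : ℤ)) : ℝ) • Q.ι₁ y₁) +
        (Homog.eval (1, 0) f • Q.ι₀ y₀ + Homog.eval (0, 1) f • Q.ι₁ y₁) := by
      refine add_le_add (Finset.sum_le_sum fun e _ => ?_) (add_le_add ?_ ?_)
      · rw [map_smul, abs_smul_of_lattice, abs_of_nonneg (hf.dyadic_nonneg e)]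
        exact smul_le_smul_of_nonneg_left (hTz e) (hf.dyadic_nonneg e)
      · rw [abs_smul_of_lattice, abs_of_nonneg hα]
        exact smul_le_smul_of_nonneg_left (hyT0 (Sum.inr i)) hα
      · rw [abs_smul_of_lattice, abs_of_nonneg hβ]
        exact smul_le_smul_of_nonneg_left (hyT1 (Sum.inr i)) hβ
    -- The sparse sum costs 5, and each boundary term one more.
    _ ≤ (5 : ℝ) • τ f + (τ f + τ f) := add_le_add h6 (add_le_add h7 h8)
    _ = (7 : ℝ) • τ f := by module

theorem abs_sup'_sub_sup'_le {L : Type*} [AddCommGroup L] [Lattice L] [IsOrderedAddMonoid L]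
    {n : ℕ} (a b : Fin (n + 1) → L) :
    |Finset.univ.sup' Finset.univ_nonempty (fun i => |a i|) -
      Finset.univ.sup' Finset.univ_nonempty (fun i => |b i|)| ≤ ∑ i, |a i - b i| := by
  have key : ∀ a b : Fin (n + 1) → L, Finset.univ.sup' Finset.univ_nonempty (fun i => |a i|) ≤
      ∑ i, |a i - b i| + Finset.univ.sup' Finset.univ_nonempty (fun i => |b i|) := by
    intro a b
    refine Finset.sup'_le _ _ fun i hi => ?_
    calc |a i| = |(a i - b i) + b i| := by rw [sub_add_cancel]
      _ ≤ |a i - b i| + |b i| := abs_add_le _ _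
      _ ≤ _ := add_le_add
        (Finset.single_le_sum (f := fun i => |a i - b i|) (fun j _ => abs_nonneg _) hi)
        (Finset.le_sup' (fun i => |b i|) hi)
  refine abs_le'.2 ⟨sub_le_iff_le_add.2 (key a b), ?_⟩
  rw [neg_sub, sub_le_iff_le_add]
  simpa only [abs_sub_comm] using key b a

theorem smul_mem_clSpace_of_le (hf : IsExtension φ f) {μ : ℝ} (hμ : 0 < μ) {y₀ : Y₀} {y₁ : Y₁}
    {τ : Homog →ₗ[ℝ] Q.Sum} (h0 : 0 ≤ y₀) (h1 : 0 ≤ y₁) (hq0 : qnorm y₀ ≤ μ) (hq1 : qnorm y₁ ≤ μ)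
    (hτ : IsKrivineCalculus (Q.ι₀ y₀) (Q.ι₁ y₁) τ) {s : Q.Sum} (hs : |s| ≤ (7 : ℝ) • τ f) :
    (7 * μ)⁻¹ • s ∈ Q.clSpace φ ∧ Q.clNorm φ ((7 * μ)⁻¹ • s) ≤ 1 := by
  have hμi : 0 ≤ μ⁻¹ := (inv_pos.2 hμ).le
  have hval : IsValue φ (Q.ι₀ (μ⁻¹ • y₀)) (Q.ι₁ (μ⁻¹ • y₁)) (μ⁻¹ • τ f) :=
    ⟨μ⁻¹ • τ, f, by rw [map_smul, map_smul]; exact hτ.smul hμi, hf, rfl⟩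
  have hle : |(7 * μ)⁻¹ • s| ≤ μ⁻¹ • τ f := by
    have h7 : 0 ≤ (7 * μ)⁻¹ := by positivity
    rw [abs_smul_of_lattice, abs_of_nonneg h7]
    refine (smul_le_smul_of_nonneg_left hs h7).trans_eq ?_
    rw [smul_smul]
    congr 1
    field_simp
  refine ⟨⟨_, _, _, smul_nonneg hμi h0, smul_nonneg hμi h1, hval, hle⟩,
    csInf_le ⟨0, fun _ hr => hr.1.le⟩ ⟨one_pos, _, _, _, smul_nonneg hμi h0, smul_nonneg hμi h1,
      ?_, ?_, hval, by rwa [one_smul]⟩⟩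
  · rwa [qnorm_smul_of_nonneg hμi, inv_mul_le_iff₀ hμ, mul_one]
  · rwa [qnorm_smul_of_nonneg hμi, inv_mul_le_iff₀ hμ, mul_one]

/-- The image of a family dominated by an approximable element lies in a multiple of the unit ball. -/
theorem IsApproximable.smul_sup'_mem_phiCBall (hφ : ClassP φ) (hf : IsExtension φ f)
    (hE : IsGrid f E) (hK : 0 < K)
    (hbdd : ∃ B : ℝ, ∀ x, Q.sumNorm (T x) ≤ B * P.sumNorm x)
    (hT₀ : ∀ x, T (P.ι₀ x) = Q.ι₀ (T₀ x)) (hT₁ : ∀ x, T (P.ι₁ x) = Q.ι₁ (T₁ x))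
    (hr₀ : RegularBound T₀ Set.univ qnorm Set.univ qnorm K)
    (hr₁ : RegularBound T₁ Set.univ qnorm Set.univ qnorm K) {c : ℝ} (hc : 0 < c) {w : P.Sum}
    (hw : P.IsApproximable f E c w) {n : ℕ} (x : Fin (n + 1) → P.Sum) (hx : ∑ i, |x i| ≤ |w|) :
    (7 * (2 * c * K))⁻¹ • Finset.univ.sup' Finset.univ_nonempty (fun i => |T (x i)|) ∈
      Q.phiCBall φ := by
  intro ε hε
  obtain ⟨B, hB⟩ := hbdd
  obtain ⟨D, hD, hDsum⟩ := Q.exists_sumNorm_sum_le (Finset.univ : Finset (Fin (n + 1)))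
  have hμ : 0 < 2 * c * K := by positivity
  set lam := (7 * (2 * c * K))⁻¹ with hlam
  have hlam0 : 0 < lam := by positivity
  -- M gathers the family size, the quasi-triangle constant and the bound of T. All of them affect
  -- only how well w must be approximated, so none enters the final constant.
  set M := lam * (D * ((n + 1) * |B|)) with hM
  have hM0 : 0 ≤ M := by positivity
  obtain ⟨J, hJ⟩ := hw (ε / (M + 1)) (by positivity)
  obtain ⟨v, hv, hlt⟩ := hJ J le_rfl
  -- The clipped family lies below the discretized v. The remainder is at most (|w| - v)⁺, small in
  -- the sum space.
  obtain ⟨p, hp, hxp⟩ := exists_clip Finset.univ x v hv.1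
  obtain ⟨y₀, y₁, τ, h0, h1, hq0, hq1, hτ, hle⟩ :=
    hv.exists_majorant (hf.isMono hφ) hE hK.le hT₀ hT₁ hr₀ hr₁ p hp
  set s := Finset.univ.sup' Finset.univ_nonempty fun i => |T (x i)| with hs
  set s' := Finset.univ.sup' Finset.univ_nonempty fun i => |T (p i)| with hs'
  have hs'0 : 0 ≤ s' := (abs_nonneg _).trans
    (Finset.le_sup' (fun i => |T (p i)|) (Finset.mem_univ 0))
  obtain ⟨hcl, hclN⟩ := smul_mem_clSpace_of_le hf hμ h0 h1 hq0 hq1 hτ (s := s') (by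
    rw [abs_of_nonneg hs'0]
    exact Finset.sup'_le _ _ fun i _ => hle i)
  refine ⟨lam • s', hcl, hclN, ?_⟩
  have hterm : ∀ i, Q.sumNorm |T (x i) - T (p i)| ≤ |B| * (ε / (M + 1)) := by
    intro i
    have e1 : Q.sumNorm |T (x i) - T (p i)| ≤ Q.sumNorm (T (x i - p i)) := by
      rw [map_sub]
      exact Q.sumNorm_mono (by rw [abs_abs])
    have e2 : P.sumNorm (x i - p i) ≤ P.sumNorm ((|w| - v) ⊔ 0) := by
      refine P.sumNorm_mono ?_
      rw [abs_of_nonneg (le_sup_right : 0 ≤ (|w| - v) ⊔ 0)]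
      exact ((Finset.single_le_sum (f := fun i => |x i - p i|) (fun j _ => abs_nonneg _)
        (Finset.mem_univ i)).trans hxp).trans (sup_le_sup_right (sub_le_sub_right hx v) 0)
    calc _ ≤ B * P.sumNorm (x i - p i) := e1.trans (hB _)
      _ ≤ |B| * P.sumNorm (x i - p i) :=
        mul_le_mul_of_nonneg_right (le_abs_self B) (P.sumNorm_nonneg _)
      _ ≤ _ := mul_le_mul_of_nonneg_left (e2.trans hlt.le) (abs_nonneg B)
  have hdiff : Q.sumNorm (s - s') ≤ D * ((n + 1) * (|B| * (ε / (M + 1)))) := by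
    have e3 : Q.sumNorm (s - s') ≤ Q.sumNorm (∑ i, |T (x i) - T (p i)|) := by
      refine Q.sumNorm_mono ?_
      rw [abs_of_nonneg (Finset.sum_nonneg fun i _ => abs_nonneg (T (x i) - T (p i)))]
      exact abs_sup'_sub_sup'_le _ _
    refine e3.trans ((hDsum _).trans (mul_le_mul_of_nonneg_left ?_ hD))
    refine (Finset.sum_le_sum fun i _ => hterm i).trans_eq ?_
    simp
  rw [← smul_sub]
  refine (Q.sumNorm_smul_le _ _).trans_lt ?_
  rw [abs_of_pos hlam0]
  calc lam * Q.sumNorm (s - s') ≤ lam * (D * ((n + 1) * (|B| * (ε / (M + 1))))) :=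
        mul_le_mul_of_nonneg_left hdiff hlam0.le
    _ = M * (ε / (M + 1)) := by rw [hM]; ring
    _ < ε := by
      rw [mul_div_assoc', div_lt_iff₀ (by positivity)]
      nlinarith

/-- A witness of membership in the Calderón–Lozanovskii space already carries an extension of φ, so
none has to be constructed. -/
theorem exists_isExtension_of_mem_phiCBall {b : P.Sum} (hb : b ∈ P.phiCBall φ) :
    ∃ f, IsExtension φ f := by
  obtain ⟨a, ⟨x₀, x₁, y, -, -, ⟨τ, f, -, hf, -⟩, -⟩, -⟩ := hb 1 one_pos
  exact ⟨f, hf⟩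

/-- The sum is approximable with some constant. The main estimate for the identity operator and this
single element converts that into membership. The quasi-norm of the sum is an infimum, and
membership makes its defining set nonempty. -/
theorem sum_abs_mem_phiC (hφ : ClassP φ) (hf : IsExtension φ f) (hE : IsGrid f E) {n : ℕ}
    (x : Fin (n + 1) → P.Sum) (hx : ∀ i, x i ∈ P.phiC φ) : ∑ i, |x i| ∈ P.phiC φ := by
  obtain ⟨c, hc⟩ := IsApproximable.sum (P := P) (f := f) (E := E) Finset.univ
    (w := fun i => |x i|) fun i _ => by
      obtain ⟨r, hr, b, hb, hxb⟩ := hx i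
      have := ((isApproximable_of_mem_phiCBall hφ hf hE hb).smul hr).abs
      exact ⟨_, by rwa [← hxb] at this⟩
  have hc' := hc.mono (le_max_left c 1)
  have hc0 : 0 < max c 1 := lt_max_of_lt_right one_pos
  have hS : 0 ≤ ∑ i, |x i| := Finset.sum_nonneg fun i _ => abs_nonneg _
  have hmem := hc'.smul_sup'_mem_phiCBall (Q := P) (T := LinearMap.id) (T₀ := LinearMap.id)
    (T₁ := LinearMap.id) (n := 0) hφ hf hE one_pos ⟨1, fun x => by simp⟩ (fun _ => rfl)
    (fun _ => rfl) (regularBound_id X₀) (regularBound_id X₁) hc0 (fun _ => ∑ i, |x i|) (by simp)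
  refine ⟨7 * (2 * max c 1 * 1), by positivity, _, hmem, ?_⟩
  rw [smul_smul, mul_inv_cancel₀ (by positivity), one_smul]
  simp [abs_of_nonneg hS]

/-- Regularity on the Gagliardo completions. -/
theorem regularBound_phiC (hφ : ClassP φ) (hK : 0 < K)
    (hbdd : ∃ B : ℝ, ∀ x, Q.sumNorm (T x) ≤ B * P.sumNorm x)
    (hT₀ : ∀ x, T (P.ι₀ x) = Q.ι₀ (T₀ x)) (hT₁ : ∀ x, T (P.ι₁ x) = Q.ι₁ (T₁ x))
    (hr₀ : RegularBound T₀ Set.univ qnorm Set.univ qnorm K)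
    (hr₁ : RegularBound T₁ Set.univ qnorm Set.univ qnorm K) :
    RegularBound T (P.phiC φ) (P.phiCNorm φ) (Q.phiC φ) (Q.phiCNorm φ) (448 * K) := by
  have main : ∀ (n : ℕ) (x : Fin (n + 1) → P.Sum) (r : ℝ) (b : P.Sum), 0 < r →
      b ∈ P.phiCBall φ → ∑ i, |x i| = r • b →
      ∃ b' ∈ Q.phiCBall φ, Finset.univ.sup' Finset.univ_nonempty (fun i => |T (x i)|) =
        (448 * K * r) • b' := by
    intro n x r b hr hb hxb
    obtain ⟨f, hf⟩ := exists_isExtension_of_mem_phiCBall hb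
    obtain ⟨E, hE⟩ := (hf.isMono hφ).exists_isGrid
    have happ := (isApproximable_of_mem_phiCBall hφ hf hE hb).smul hr
    have hmem := happ.smul_sup'_mem_phiCBall hφ hf hE hK hbdd hT₀ hT₁ hr₀ hr₁ (by positivity) x
      (hxb.le.trans (le_abs_self _))
    refine ⟨_, hmem, ?_⟩
    -- Here 32 comes from the discretization of the ball, 2 from merging dyadic and boundary pieces,
    -- and 7 from resumming.
    have e : 7 * (2 * (r * 32) * K) = 448 * K * r := by ring
    rw [e, smul_smul, mul_inv_cancel₀ (by positivity), one_smul]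
  refine ⟨?_, fun n x hx => ?_⟩
  · rintro x ⟨r, hr, b, hb, rfl⟩
    -- A one-member family is used; its sum of absolute values is a multiple of |b|. Solidity of the
    -- target ball then passes from |T x| to T x.
    have hb' : |b| ∈ P.phiCBall φ := mem_phiCBall_of_abs_le hb (by rw [abs_abs])
    obtain ⟨b', hb', h⟩ := main 0 (fun _ => r • b) r |b| hr hb' (by
      simp [abs_smul_of_lattice, abs_of_pos hr])
    have hpos : 0 < 448 * K * r := by positivity
    refine ⟨448 * K * r, hpos, (448 * K * r)⁻¹ • T (r • b), mem_phiCBall_of_abs_le hb' ?_, ?_⟩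
    · have h2 : |T (r • b)| = (448 * K * r) • b' := by simpa using h
      rw [abs_smul_of_lattice, h2, smul_smul, abs_of_pos (inv_pos.2 hpos),
        inv_mul_cancel₀ hpos.ne', one_smul]
      exact le_abs_self b'
    · rw [smul_smul, mul_inv_cancel₀ hpos.ne', one_smul]
  · have hS : ∑ i, |x i| ∈ P.phiC φ := by
      obtain ⟨r, hr, b, hb, -⟩ := hx 0
      obtain ⟨f, hf⟩ := exists_isExtension_of_mem_phiCBall hb
      obtain ⟨E, hE⟩ := (hf.isMono hφ).exists_isGrid
      exact sum_abs_mem_phiC hφ hf hE x hx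
    have h448 : 0 < 448 * K := by positivity
    constructor
    · obtain ⟨r, hr, b, hb, hSb⟩ := hS
      obtain ⟨b', hb', h⟩ := main n x r b hr hb hSb
      exact ⟨448 * K * r, by positivity, b', hb', h⟩
    · rw [← div_le_iff₀' h448]
      refine le_csInf hS ?_
      rintro r ⟨hr, b, hb, hSb⟩
      obtain ⟨b', hb', h⟩ := main n x r b hr hb hSb
      rw [div_le_iff₀' h448]
      exact csInf_le ⟨0, fun _ hr => hr.1.le⟩ ⟨by positivity, b', hb', h⟩

end CompatiblePair

end CalderonLozanovskii

/-! ### The interpolation theorem. -/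

open CalderonLozanovskii in
theorem theorem3p1 {X₀ : Type*} {X₁ : Type*} {Y₀ : Type*} {Y₁ : Type*}
    [QuasiBanachLattice X₀] [QuasiBanachLattice X₁] [QuasiBanachLattice Y₀] [QuasiBanachLattice Y₁]
    (φ : ℝ → ℝ → ℝ) (hφ : ClassP φ) :
    ∃ C : ℝ, 0 < C ∧
      ∀ (P : CompatiblePair X₀ X₁) (Q : CompatiblePair Y₀ Y₁) (T : P.Sum →ₗ[ℝ] Q.Sum)
        (T₀ : X₀ →ₗ[ℝ] Y₀) (T₁ : X₁ →ₗ[ℝ] Y₁),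
        (∃ K : ℝ, ∀ x, Q.sumNorm (T x) ≤ K * P.sumNorm x) →
        (∀ x, T (P.ι₀ x) = Q.ι₀ (T₀ x)) →
        (∀ x, T (P.ι₁ x) = Q.ι₁ (T₁ x)) →
        IsInftyOneRegular T₀ Set.univ QuasiBanachLattice.qnorm Set.univ QuasiBanachLattice.qnorm →
        IsInftyOneRegular T₁ Set.univ QuasiBanachLattice.qnorm Set.univ QuasiBanachLattice.qnorm →
        Set.MapsTo T (P.phiC φ) (Q.phiC φ) ∧
        IsInftyOneRegular T (P.phiC φ) (P.phiCNorm φ) (Q.phiC φ) (Q.phiCNorm φ) ∧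
        rhoInftyOne T (P.phiC φ) (P.phiCNorm φ) (Q.phiC φ) (Q.phiCNorm φ) ≤
          C * max
            (rhoInftyOne T₀ Set.univ QuasiBanachLattice.qnorm Set.univ QuasiBanachLattice.qnorm)
            (rhoInftyOne T₁ Set.univ QuasiBanachLattice.qnorm Set.univ
              QuasiBanachLattice.qnorm) := by
  refine ⟨448, by norm_num, fun P Q T T₀ T₁ hbdd hT₀ hT₁ hreg₀ hreg₁ => ?_⟩
  -- The infima defining the regularity constants need not be attained, so the estimate is proved
  -- for every K above their maximum; letting K decrease gives the bound.
  have key : ∀ K : ℝ,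
      max (rhoInftyOne T₀ Set.univ QuasiBanachLattice.qnorm Set.univ QuasiBanachLattice.qnorm)
        (rhoInftyOne T₁ Set.univ QuasiBanachLattice.qnorm Set.univ QuasiBanachLattice.qnorm) < K →
      0 < K ∧ RegularBound T (P.phiC φ) (P.phiCNorm φ) (Q.phiC φ) (Q.phiCNorm φ) (448 * K) := by
    intro K hK
    obtain ⟨K₀, ⟨hK₀, hb₀⟩, hlt₀⟩ := exists_lt_of_csInf_lt hreg₀ ((le_max_left _ _).trans_lt hK)
    obtain ⟨K₁, ⟨hK₁, hb₁⟩, hlt₁⟩ := exists_lt_of_csInf_lt hreg₁ ((le_max_right _ _).trans_lt hK)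
    have hK0 : 0 < K := hK₀.trans hlt₀
    exact ⟨hK0, CompatiblePair.regularBound_phiC hφ hK0 hbdd hT₀ hT₁
      (hb₀.mono QuasiBanachLattice.qnorm_nonneg hlt₀.le)
      (hb₁.mono QuasiBanachLattice.qnorm_nonneg hlt₁.le)⟩
  obtain ⟨hK, hb⟩ := key _ (lt_add_one _)
  refine ⟨hb.1, ⟨_, by positivity, hb⟩, ?_⟩
  rw [← div_le_iff₀' (by norm_num : (0 : ℝ) < 448)]
  refine le_of_forall_gt_imp_ge_of_dense fun K hK => ?_
  obtain ⟨hK0, hb⟩ := key K hK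
  rw [div_le_iff₀' (by norm_num : (0 : ℝ) < 448)]
  exact csInf_le ⟨0, fun _ hr => hr.1.le⟩ ⟨by positivity, hb⟩
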